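/- Let $u\in C^1(\mathbb{R})$ be real-valued with $u(x)\to 2\pi k$ both as $x\to-\infty$ and as $x\to+\infty$ for some $k\in\mathbb{Z}$ (topological charge $0$). Suppose that $\sin(u/2)\in L^1(\mathbb{R})$ is of fixed sign and has exactly one critical point $x_0$, that $1-|\cos(u/2)|\in L^1(\mathbb{R})$, and that $|u(x_0)-2\pi k|<\pi$. Consider the sine-Gordon (Kaup) scattering problem for stationary data ($u_t=0$), $$\Phi_x=\frac14\Big(z-\frac1z\Big)\cos\Big(\frac u2\Big)\begin{pmatrix}-i&0\\0&i\end{pmatrix}\Phi+\frac14\Big(z+\frac1z\Big)\sin\Big(\frac u2\Big)\begin{pmatrix}0&i\\i&0\end{pmatrix}\Phi,\qquad \Phi:\mathbb{R}\to\mathbb{C}^2,$$ where $z\in\mathbb{C}\setminus\{0\}$ is called an eigenvalue if there is a nontrivial solution $\Phi\in L^2(\mathbb{R};\mathbb{C}^2)$. Then every eigenvalue $z$ satisfies $|z|=1$ and is simple. Here an eigenvalue $z$ is simple if its eigenspace is one-dimensional and $\dot W(z)\neq0$, where $\dot{}$ is the derivative in $z$ and $W(w)=\psi_1\phi_2-\psi_2\phi_1$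 is the ($x$-independent) Wronskian of the Jost solutions $\Psi=(\psi_1,\psi_2)^T$ and $\Phi=(\phi_1,\phi_2)^T$ at $w$. The Jost solution $\Psi$ (respectively $\Phi$) is the solution asymptotic, as $x\to-\infty$ (respectively $x\to+\infty$), to the one of the two plane waves $\exp\big(\mp\frac i4(w-\frac1w)\int_0^x\cos(\frac u2)\,dy\big)e_{\pm}$ that decays there, with $e_+=(1,0)^T$, $e_-=(0,1)^T$, in the sense that the solution divided by the scalar exponential tends to $e_\pm$. (If $u\to0$ and $\operatorname{Im}w>0$, the vector is $(1,0)^T$ at $-\infty$ and $(0,1)^T$ at $+\infty$.) The existence of these Jost solutions for all $w$ near $z$ and the differentiability of $W$ at $z$ are part of the conclusion. -/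

import Mathlib

open Filter Topology MeasureTheory

namespace SineGordon

/-- `τ₁ = diag(-i, i)`. -/
noncomputable def tau1 : Matrix (Fin 2) (Fin 2) ℂ := !![-Complex.I, 0; 0, Complex.I]

/-- `τ₂`, the off-diagonal matrix with both entries `i`. -/
noncomputable def tau2 : Matrix (Fin 2) (Fin 2) ℂ := !![0, Complex.I; Complex.I, 0]

/-- Coefficient matrix, at the point `x`, of the sine-Gordon (Kaup) scattering problem in
laboratory coordinates, for stationary data `u_t = 0`:
`¼ (z - 1/z) cos(u/2) τ₁ + ¼ (z + 1/z) sin(u/2) τ₂`. -/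
noncomputable def coeff (u : ℝ → ℝ) (z : ℂ) (x : ℝ) : Matrix (Fin 2) (Fin 2) ℂ :=
  ((1 / 4 : ℂ) * (z - 1 / z) * (Real.cos (u x / 2) : ℂ)) • tau1
    + ((1 / 4 : ℂ) * (z + 1 / z) * (Real.sin (u x / 2) : ℂ)) • tau2

/-- `Φ` is a (classical) solution on `ℝ` of the scattering problem `Φ_x = coeff u z x Φ`. -/
def IsSolution (u : ℝ → ℝ) (z : ℂ) (Φ : ℝ → Fin 2 → ℂ) : Prop :=
  ∀ x : ℝ, HasDerivAt Φ ((coeff u z x).mulVec (Φ x)) x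

/-- `Φ` is an eigenfunction for the spectral parameter `z`: a nontrivial `L²(ℝ; ℂ²)` solution. -/
def IsEigenfunction (u : ℝ → ℝ) (z : ℂ) (Φ : ℝ → Fin 2 → ℂ) : Prop :=
  IsSolution u z Φ ∧ MemLp Φ 2 volume ∧ Φ ≠ 0

/-- `z` is a (discrete) eigenvalue of the scattering problem. -/
def IsEigenvalue (u : ℝ → ℝ) (z : ℂ) : Prop :=
  z ≠ 0 ∧ ∃ Φ : ℝ → Fin 2 → ℂ, IsEigenfunction u z Φ

/-- The `j`-th diagonal entry of `exp (¼ (z - 1/z) (∫_0^x cos(u/2) dy) τ₁)`. -/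
noncomputable def planeWave (u : ℝ → ℝ) (z : ℂ) (j : Fin 2) (x : ℝ) : ℂ :=
  Complex.exp ((1 / 4 : ℂ) * (z - 1 / z)
    * ((∫ y in (0 : ℝ)..x, Real.cos (u y / 2) : ℝ) : ℂ) * tau1 j j)

/-- `Ψ` is the Jost solution at the end `l` of the line (`l = atBot` or `l = atTop`): it solves the
scattering problem and is asymptotic there to the decaying one of the two plane waves
`exp (¼ (z - 1/z) (∫_0^x cos(u/2) dy) τ₁) eⱼ`, where `e₀ = (1,0)ᵀ` and `e₁ = (0,1)ᵀ`. If `u → 0` at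
both ends and `0 < Im z`, then `j = 0` at `atBot` and `j = 1` at `atTop`. -/
def IsJost (u : ℝ → ℝ) (z : ℂ) (l : Filter ℝ) (Ψ : ℝ → Fin 2 → ℂ) : Prop :=
  IsSolution u z Ψ ∧ ∃ j : Fin 2,
    Tendsto (planeWave u z j) l (𝓝 0) ∧
    Tendsto (fun x => (planeWave u z j x)⁻¹ • Ψ x) l (𝓝 (Pi.single j 1))

/-- The Wronskian `ψ₁ φ₂ - ψ₂ φ₁` of two vectors. -/
def wronskian (v w : Fin 2 → ℂ) : ℂ := v 0 * w 1 - v 1 * w 0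

/-- `z` is a simple eigenvalue: its eigenfunctions are all proportional, and the Wronskian
`W(w)` of the Jost solutions at `-∞` and `+∞` (which does not depend on the point `x` at which it
is evaluated, here `x = 0`), defined for `w` near `z`, has a nonzero complex derivative at `z`. -/
def IsSimpleEigenvalue (u : ℝ → ℝ) (z : ℂ) : Prop :=
  IsEigenvalue u z ∧
  (∀ Φ₁ Φ₂ : ℝ → Fin 2 → ℂ, IsEigenfunction u z Φ₁ → IsEigenfunction u z Φ₂ →
    ∃ c : ℂ, Φ₂ = c • Φ₁) ∧
  ∃ Ψ Φ : ℂ → ℝ → Fin 2 → ℂ,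
    (∀ᶠ w in 𝓝 z, IsJost u w atBot (Ψ w) ∧ IsJost u w atTop (Φ w)) ∧
    ∃ W' : ℂ, HasDerivAt (fun w => wronskian (Ψ w 0) (Φ w 0)) W' z ∧ W' ≠ 0

end SineGordon

/-! ### The first-order system: symmetries, Wronskian, density -/

namespace SineGordon

/-! After absorbing signs, the problem reads `f' = -i l C f + i m S g`, `g' = i m S f + i l C g`,
where `C = |cos(u/2)|`, `S = |sin(u/2)|`, `l = ±(z - 1/z)/4`, `m = ±(z + 1/z)/4` and `m² - l² =
1/4`. The hypotheses make `(C, S)` a curve in the open first quadrant of the unit circle with `S`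
rising up to `x₀` and falling after it (`exists_lobe`). Exchanging the components allows `Im l > 0`;
for `Im l = 0` both parameters are real, `|f|² + |g|²` is constant, and there is no eigenvalue.

Both conclusions come from one monotone quantity built on the cotangent `C/S`, which decreases to
the left of `x₀`.

Modulus: put `k = Im m / Im l`. The relation between `m` and `l` gives `Re l = k Re m` and `|k| <
1`. If `k ≠ 0`, the quantity `Re(f conj g)/k + (C/S)|g|²` starts from `0` at `-∞` and strictly
decreases up to `x₀`, because the terms in `Im(f conj g)` cancel and the rest is a definite
quadratic form. Hence `Re(f conj g)/k < 0` at `x₀` (`Sol.re_mul_conj_neg`). Reflecting the line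
exchanges `f` and `g` and changes the sign of `k`, so the decay at `+∞` gives the opposite sign.
Therefore `Im m = 0 = Re l`, which is `|z| = 1` (`Sol.im_eq_zero`). The boundary value at `-∞` rests
on `|g| = O(S)` there (`Sol.tendsto_cot_mul`).

Simplicity: two decaying solutions have zero Wronskian, so the eigenspace is a line. On the unit
circle `l = iA` and `m = B` with `A`, `B` real, and there is an eigenfunction `(p, iq)` with `p`,
`q` real. The derivative of the Wronskian of the Jost solutions is a nonzero multiple of the
integral of `2 B C p q + A S (p² + q²)` (`Sol.exists_jost_pair`). On the left half-line `(C/S) q²`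
minus the integral of this form from `-∞` is again decreasing from `0`, so the integral up to `x₀`
is positive; reflection treats the other half (`Sol.integral_form_pos`).

The Jost solutions come from a contraction for a weighted Volterra system (`Lobe.exists_jost`). Only
their continuity in the parameters is proved: since the Wronskian vanishes at the eigenvalue, its
difference quotient is an explicit integral, and dominated convergence gives the derivative. -/

open Complex in
/-- The pair `(f, g)` solves `f' = -i l C f + i m S g`, `g' = i m S f + i l C g`. -/
structure Sol (C S : ℝ → ℝ) (l m : ℂ) (f g : ℝ → ℂ) : Prop where
  left : ∀ x, HasDerivAt f (-I * l * C x * f x + I * m * S x * g x) x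
  right : ∀ x, HasDerivAt g (I * m * S x * f x + I * l * C x * g x) x

namespace Sol

variable {C S : ℝ → ℝ} {l m l' m' : ℂ} {f g f' g' : ℝ → ℂ}

/-- Reduces the case `Im l < 0` to `Im l > 0` without changing the profile. -/
lemma swap (h : Sol C S l m f g) : Sol C S (-l) m g f :=
  ⟨fun x => (h.right x).congr_deriv (by ring), fun x => (h.left x).congr_deriv (by ring)⟩

/-- Carries every statement about `-∞` and the left of the lobe to `+∞` and its right. The sign
change of `m` is what makes the two halves contradict each other when `Im m ≠ 0`. -/
lemma reflect (h : Sol C S l m f g) :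
    Sol (fun x => C (-x)) (fun x => S (-x)) l (-m) (fun x => g (-x)) (fun x => f (-x)) := by
  refine ⟨fun x => ?_, fun x => ?_⟩
  · exact ((h.right (-x)).scomp x (hasDerivAt_neg x)).congr_deriv (by simp; ring)
  · exact ((h.left (-x)).scomp x (hasDerivAt_neg x)).congr_deriv (by simp; ring)

lemma const_mul (h : Sol C S l m f g) (c : ℂ) :
    Sol C S l m (fun x => c * f x) (fun x => c * g x) :=
  ⟨fun x => ((h.left x).const_mul c).congr_deriv (by ring),
    fun x => ((h.right x).const_mul c).congr_deriv (by ring)⟩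

lemma sub (h : Sol C S l m f g) (h' : Sol C S l m f' g') :
    Sol C S l m (fun x => f x - f' x) (fun x => g x - g' x) :=
  ⟨fun x => ((h.left x).sub (h'.left x)).congr_deriv (by ring),
    fun x => ((h.right x).sub (h'.right x)).congr_deriv (by ring)⟩

lemma continuous_left (h : Sol C S l m f g) : Continuous f :=
  continuous_iff_continuousAt.2 fun x => (h.left x).continuousAt

lemma continuous_right (h : Sol C S l m f g) : Continuous g :=
  continuous_iff_continuousAt.2 fun x => (h.right x).continuousAt

open Complex in
-- The coefficient matrix has trace zero, so only the differences of the parameters survive. Equal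
-- parameters give a constant Wronskian; nearby ones give its derivative in the spectral parameter.
lemma hasDerivAt_wronskian (h : Sol C S l m f g) (h' : Sol C S l' m' f' g') (x : ℝ) :
    HasDerivAt (fun x => f x * g' x - g x * f' x)
      (-I * (l - l') * C x * (f x * g' x + g x * f' x)
        + I * (m - m') * S x * (g x * g' x - f x * f' x)) x :=
  (((h.left x).mul (h'.right x)).sub ((h.right x).mul (h'.left x))).congr_deriv (by ring)

lemma hasDerivAt_re {f : ℝ → ℂ} {f' : ℂ} {x : ℝ} (h : HasDerivAt f f' x) :
    HasDerivAt (fun x => (f x).re) f'.re x :=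
  (Complex.reCLM.hasFDerivAt.comp_hasDerivAt x h)

lemma hasDerivAt_im {f : ℝ → ℂ} {f' : ℂ} {x : ℝ} (h : HasDerivAt f f' x) :
    HasDerivAt (fun x => (f x).im) f'.im x :=
  (Complex.imCLM.hasFDerivAt.comp_hasDerivAt x h)

lemma hasDerivAt_left_re (h : Sol C S l m f g) (x : ℝ) :
    HasDerivAt (fun x => (f x).re) (C x * (l.im * (f x).re + l.re * (f x).im)
      + S x * (-m.im * (g x).re - m.re * (g x).im)) x :=
  (hasDerivAt_re (h.left x)).congr_deriv (by simp; ring)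

lemma hasDerivAt_left_im (h : Sol C S l m f g) (x : ℝ) :
    HasDerivAt (fun x => (f x).im) (C x * (l.im * (f x).im - l.re * (f x).re)
      + S x * (-m.im * (g x).im + m.re * (g x).re)) x :=
  (hasDerivAt_im (h.left x)).congr_deriv (by simp; ring)

lemma hasDerivAt_right_re (h : Sol C S l m f g) (x : ℝ) :
    HasDerivAt (fun x => (g x).re) (C x * (-l.im * (g x).re - l.re * (g x).im)
      + S x * (-m.im * (f x).re - m.re * (f x).im)) x :=
  (hasDerivAt_re (h.right x)).congr_deriv (by simp; ring)

lemma hasDerivAt_right_im (h : Sol C S l m f g) (x : ℝ) :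
    HasDerivAt (fun x => (g x).im) (C x * (-l.im * (g x).im + l.re * (g x).re)
      + S x * (-m.im * (f x).im + m.re * (f x).re)) x :=
  (hasDerivAt_im (h.right x)).congr_deriv (by simp; ring)

end Sol

/-- The squared Euclidean norm of the pair `(f x, g x)`. -/
def density (f g : ℝ → ℂ) (x : ℝ) : ℝ := Complex.normSq (f x) + Complex.normSq (g x)

namespace Sol

variable {C S : ℝ → ℝ} {l m l' m' : ℂ} {f g f' g' : ℝ → ℂ}

lemma hasDerivAt_normSq_right (h : Sol C S l m f g) (x : ℝ) :
    HasDerivAt (fun x => Complex.normSq (g x))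
      (-2 * l.im * C x * Complex.normSq (g x)
        - 2 * S x * (m.re * ((f x).im * (g x).re - (f x).re * (g x).im)
          + m.im * ((f x).re * (g x).re + (f x).im * (g x).im))) x := by
  have := ((h.hasDerivAt_right_re x).mul (h.hasDerivAt_right_re x)).add
    ((h.hasDerivAt_right_im x).mul (h.hasDerivAt_right_im x))
  simp only [Complex.normSq_apply]
  exact this.congr_deriv (by ring)

lemma hasDerivAt_density (h : Sol C S l m f g) (x : ℝ) :
    HasDerivAt (density f g)
      (2 * l.im * C x * (Complex.normSq (f x) - Complex.normSq (g x))
        - 4 * S x * m.im * ((f x).re * (g x).re + (f x).im * (g x).im)) x := by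
  have := (((h.hasDerivAt_left_re x).mul (h.hasDerivAt_left_re x)).add
    ((h.hasDerivAt_left_im x).mul (h.hasDerivAt_left_im x))).add
    (((h.hasDerivAt_right_re x).mul (h.hasDerivAt_right_re x)).add
    ((h.hasDerivAt_right_im x).mul (h.hasDerivAt_right_im x)))
  unfold density
  simp only [Complex.normSq_apply]
  exact this.congr_deriv (by ring)

lemma hasDerivAt_re_mul_conj (h : Sol C S l m f g) (x : ℝ) :
    HasDerivAt (fun x => (f x).re * (g x).re + (f x).im * (g x).im)
      (2 * l.re * C x * ((f x).im * (g x).re - (f x).re * (g x).im)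
        - S x * m.im * density f g x) x := by
  have := ((h.hasDerivAt_left_re x).mul (h.hasDerivAt_right_re x)).add
    ((h.hasDerivAt_left_im x).mul (h.hasDerivAt_right_im x))
  unfold density
  simp only [Complex.normSq_apply]
  exact this.congr_deriv (by ring)

lemma density_nonneg (f g : ℝ → ℂ) (x : ℝ) : 0 ≤ density f g x :=
  add_nonneg (Complex.normSq_nonneg _) (Complex.normSq_nonneg _)

lemma abs_deriv_density_le {c s : ℝ} (hc : |c| ≤ 1) (hs : |s| ≤ 1) (p q : ℂ) (l m : ℝ) :
    |2 * l * c * (Complex.normSq p - Complex.normSq q)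
        - 4 * s * m * (p.re * q.re + p.im * q.im)|
      ≤ (2 * |l| + 2 * |m|) * (Complex.normSq p + Complex.normSq q) := by
  have h1 : |Complex.normSq p - Complex.normSq q| ≤ Complex.normSq p + Complex.normSq q := by
    rw [abs_le]
    constructor <;> linarith [Complex.normSq_nonneg p, Complex.normSq_nonneg q]
  have h2 : |2 * (p.re * q.re + p.im * q.im)| ≤ Complex.normSq p + Complex.normSq q := by
    rw [abs_le, Complex.normSq_apply, Complex.normSq_apply]
    constructor <;> nlinarith [sq_nonneg (p.re - q.re), sq_nonneg (p.im - q.im),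
      sq_nonneg (p.re + q.re), sq_nonneg (p.im + q.im)]
  have h3 : |2 * l * c * (Complex.normSq p - Complex.normSq q)|
      ≤ 2 * |l| * (Complex.normSq p + Complex.normSq q) := by
    rw [abs_mul, abs_mul, abs_mul, abs_two]
    have : 2 * |l| * |c| ≤ 2 * |l| := mul_le_of_le_one_right (by positivity) hc
    gcongr
  have h4 : |4 * s * m * (p.re * q.re + p.im * q.im)|
      ≤ 2 * |m| * (Complex.normSq p + Complex.normSq q) := by
    rw [show 4 * s * m * (p.re * q.re + p.im * q.im)
      = 2 * m * s * (2 * (p.re * q.re + p.im * q.im)) by ring, abs_mul, abs_mul, abs_mul, abs_two]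
    have : 2 * |m| * |s| ≤ 2 * |m| := mul_le_of_le_one_right (by positivity) hs
    gcongr
  calc _ ≤ _ := abs_sub _ _
    _ ≤ _ := add_le_add h3 h4
    _ = _ := by ring

/-- The derivative of the density is bounded by a multiple of the density, hence integrable too; an
integrable function with integrable derivative vanishes at both ends. -/
lemma tendsto_density_zero (h : Sol C S l m f g) (hC : ∀ x, |C x| ≤ 1) (hS : ∀ x, |S x| ≤ 1)
    (hCc : Continuous C) (hSc : Continuous S) (hi : Integrable (density f g)) :
    Tendsto (density f g) atBot (𝓝 0) ∧ Tendsto (density f g) atTop (𝓝 0) := by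
  have hfc := h.continuous_left
  have hgc := h.continuous_right
  have hd : Integrable (fun x => 2 * l.im * C x * (Complex.normSq (f x) - Complex.normSq (g x))
        - 4 * S x * m.im * ((f x).re * (g x).re + (f x).im * (g x).im)) := by
    refine (hi.const_mul (2 * |l.im| + 2 * |m.im|)).mono' ?_ (Eventually.of_forall fun x => ?_)
    · refine Continuous.aestronglyMeasurable ?_
      have := Complex.continuous_normSq.comp hfc
      have := Complex.continuous_normSq.comp hgc
      have := Complex.continuous_re.comp hfc
      have := Complex.continuous_re.comp hgc
      have := Complex.continuous_im.comp hfc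
      have := Complex.continuous_im.comp hgc
      simp only [Function.comp_def] at *
      fun_prop
    · exact abs_deriv_density_le (hC x) (hS x) _ _ _ _
  exact ⟨tendsto_zero_of_hasDerivAt_of_integrableOn_Iic (a := 0)
      (fun x _ => h.hasDerivAt_density x) hd.integrableOn hi.integrableOn,
    tendsto_zero_of_hasDerivAt_of_integrableOn_Ioi (a := 0)
      (fun x _ => h.hasDerivAt_density x) hd.integrableOn hi.integrableOn⟩

/-- Gronwall in both directions: the density times `exp (K x)` increases and times `exp (-K x)`
decreases. This serves as uniqueness for the linear system. -/
lemma density_eq_zero (h : Sol C S l m f g) (hC : ∀ x, |C x| ≤ 1) (hS : ∀ x, |S x| ≤ 1)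
    {x₁ : ℝ} (h0 : density f g x₁ = 0) (x : ℝ) : density f g x = 0 := by
  set K := 2 * |l.im| + 2 * |m.im|
  have key : ∀ x, |2 * l.im * C x * (Complex.normSq (f x) - Complex.normSq (g x))
        - 4 * S x * m.im * ((f x).re * (g x).re + (f x).im * (g x).im)| ≤ K * density f g x :=
    fun x => abs_deriv_density_le (hC x) (hS x) _ _ _ _
  have hm : ∀ c x, HasDerivAt (fun x => Real.exp (c * x) * density f g x)
      (Real.exp (c * x) * (2 * l.im * C x * (Complex.normSq (f x) - Complex.normSq (g x))
        - 4 * S x * m.im * ((f x).re * (g x).re + (f x).im * (g x).im) + c * density f g x)) x :=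
    fun c x => ((((hasDerivAt_id x).const_mul c).exp).mul (h.hasDerivAt_density x)).congr_deriv
      (by simp; ring)
  have mono : Monotone (fun x => Real.exp (K * x) * density f g x) :=
    monotone_of_hasDerivAt_nonneg (hm K) fun x => mul_nonneg (Real.exp_pos _).le
      (by linarith [neg_abs_le (2 * l.im * C x * (Complex.normSq (f x) - Complex.normSq (g x))
        - 4 * S x * m.im * ((f x).re * (g x).re + (f x).im * (g x).im)), key x])
  have anti : Antitone (fun x => Real.exp (-K * x) * density f g x) :=
    antitone_of_hasDerivAt_nonpos (hm (-K)) fun x => mul_nonpos_of_nonneg_of_nonpos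
      (Real.exp_pos _).le
      (by linarith [le_abs_self (2 * l.im * C x * (Complex.normSq (f x) - Complex.normSq (g x))
        - 4 * S x * m.im * ((f x).re * (g x).re + (f x).im * (g x).im)), key x])
  refine le_antisymm ?_ (density_nonneg f g x)
  rcases le_total x x₁ with hx | hx
  · have := mono hx
    simp only [h0, mul_zero] at this
    exact nonpos_of_mul_nonpos_right this (Real.exp_pos _)
  · have := anti hx
    simp only [h0, mul_zero] at this
    exact nonpos_of_mul_nonpos_right this (Real.exp_pos _)

lemma eq_zero_of_density {x : ℝ} (h : density f g x = 0) : f x = 0 ∧ g x = 0 := by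
  unfold density at h
  have h1 := Complex.normSq_nonneg (f x)
  have h2 := Complex.normSq_nonneg (g x)
  exact ⟨Complex.normSq_eq_zero.1 (by linarith), Complex.normSq_eq_zero.1 (by linarith)⟩

/-- Two solutions with vanishing Wronskian are proportional. -/
lemma exists_proportional (h : Sol C S l m f g) (h' : Sol C S l m f' g')
    (hC : ∀ x, |C x| ≤ 1) (hS : ∀ x, |S x| ≤ 1) {x₁ : ℝ} (hne : density f g x₁ ≠ 0)
    (hW : f x₁ * g' x₁ - g x₁ * f' x₁ = 0) :
    ∃ c : ℂ, ∀ x, f' x = c * f x ∧ g' x = c * g x := by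
  obtain ⟨c, hc1, hc2⟩ : ∃ c : ℂ, f' x₁ = c * f x₁ ∧ g' x₁ = c * g x₁ := by
    by_cases hf : f x₁ = 0
    · have hg : g x₁ ≠ 0 := by
        rintro hg
        simp [density, hf, hg] at hne
      refine ⟨g' x₁ / g x₁, ?_, by field_simp⟩
      rw [hf] at hW ⊢
      simpa [hg] using hW
    · refine ⟨f' x₁ / f x₁, by field_simp, ?_⟩
      field_simp
      linear_combination hW
  refine ⟨c, fun x => ?_⟩
  have := (h'.sub (h.const_mul c)).density_eq_zero hC hS (x₁ := x₁)
    (by simp [density, hc1, hc2]) x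
  have := eq_zero_of_density this
  exact ⟨sub_eq_zero.1 this.1, sub_eq_zero.1 this.2⟩

lemma wronskian_const (h : Sol C S l m f g) (h' : Sol C S l m f' g') (x y : ℝ) :
    f x * g' x - g x * f' x = f y * g' y - g y * f' y :=
  is_const_of_deriv_eq_zero (f := fun x => f x * g' x - g x * f' x)
    (fun x => (h.hasDerivAt_wronskian h' x).differentiableAt)
    (fun x => (h.hasDerivAt_wronskian h' x).deriv.trans (by simp)) x y

lemma tendsto_components {L : Filter ℝ} (h : Tendsto (density f g) L (𝓝 0)) :
    Tendsto f L (𝓝 0) ∧ Tendsto g L (𝓝 0) := by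
  have aux : ∀ p : ℝ → ℂ, (∀ x, Complex.normSq (p x) ≤ density f g x) → Tendsto p L (𝓝 0) := by
    intro p hp
    rw [tendsto_zero_iff_norm_tendsto_zero]
    have h1 := squeeze_zero (fun x => Complex.normSq_nonneg (p x)) hp h
    have h2 := (Real.continuous_sqrt.tendsto 0).comp h1
    rw [Real.sqrt_zero] at h2
    refine h2.congr fun x => ?_
    simp [Complex.normSq_eq_norm_sq]
  exact ⟨aux f fun x => le_add_of_nonneg_right (Complex.normSq_nonneg _),
    aux g fun x => le_add_of_nonneg_left (Complex.normSq_nonneg _)⟩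

lemma wronskian_eq_zero (h : Sol C S l m f g) (h' : Sol C S l m f' g') {L : Filter ℝ} [L.NeBot]
    (hf : Tendsto f L (𝓝 0)) (hg : Tendsto g L (𝓝 0)) (hf' : Tendsto f' L (𝓝 0))
    (hg' : Tendsto g' L (𝓝 0)) (x : ℝ) : f x * g' x - g x * f' x = 0 := by
  have h1 : Tendsto (fun y => f y * g' y - g y * f' y) L (𝓝 (0 * 0 - 0 * 0)) :=
    (hf.mul hg').sub (hg.mul hf')
  have h2 : (fun y => f y * g' y - g y * f' y) = fun _ => f x * g' x - g x * f' x :=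
    funext fun y => h.wronskian_const h' y x
  rw [h2] at h1
  simpa using tendsto_nhds_unique tendsto_const_nhds h1

end Sol
end SineGordon
-- Lobe profiles and decay at the left end
namespace SineGordon

/-- A single-lobe profile: `(C, S)` is a curve in the open first quadrant of the unit circle,
`S` is integrable, vanishes at both ends, increases up to `x₀` and decreases after it. -/
structure Lobe (C S dS : ℝ → ℝ) (x₀ : ℝ) : Prop where
  C_pos : ∀ x, 0 < C x
  S_pos : ∀ x, 0 < S x
  sq_add_sq : ∀ x, C x ^ 2 + S x ^ 2 = 1
  hasDerivAt_S : ∀ x, HasDerivAt S (dS x) x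
  hasDerivAt_C : ∀ x, HasDerivAt C (-(S x * dS x / C x)) x
  dS_nonneg : ∀ x, x < x₀ → 0 ≤ dS x
  dS_nonpos : ∀ x, x₀ < x → dS x ≤ 0
  tendsto_bot : Tendsto S atBot (𝓝 0)
  tendsto_top : Tendsto S atTop (𝓝 0)
  integrable : Integrable S

namespace Lobe

variable {C S dS : ℝ → ℝ} {x₀ : ℝ}

lemma reflect (H : Lobe C S dS x₀) :
    Lobe (fun x => C (-x)) (fun x => S (-x)) (fun x => -dS (-x)) (-x₀) where
  C_pos x := H.C_pos _
  S_pos x := H.S_pos _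
  sq_add_sq x := H.sq_add_sq _
  hasDerivAt_S x := ((H.hasDerivAt_S (-x)).scomp x (hasDerivAt_neg x)).congr_deriv (by simp)
  hasDerivAt_C x := ((H.hasDerivAt_C (-x)).scomp x (hasDerivAt_neg x)).congr_deriv
    (by simp; ring)
  dS_nonneg x hx := by linarith [H.dS_nonpos (-x) (by linarith)]
  dS_nonpos x hx := by linarith [H.dS_nonneg (-x) (by linarith)]
  tendsto_bot := H.tendsto_top.comp tendsto_neg_atBot_atTop
  tendsto_top := H.tendsto_bot.comp tendsto_neg_atTop_atBot
  integrable := H.integrable.comp_neg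

lemma continuous_S (H : Lobe C S dS x₀) : Continuous S :=
  continuous_iff_continuousAt.2 fun x => (H.hasDerivAt_S x).continuousAt

lemma continuous_C (H : Lobe C S dS x₀) : Continuous C :=
  continuous_iff_continuousAt.2 fun x => (H.hasDerivAt_C x).continuousAt

lemma C_le_one (H : Lobe C S dS x₀) (x : ℝ) : C x ≤ 1 := by
  nlinarith [H.sq_add_sq x, H.C_pos x, sq_nonneg (S x)]

lemma S_le_one (H : Lobe C S dS x₀) (x : ℝ) : S x ≤ 1 := by
  nlinarith [H.sq_add_sq x, H.S_pos x, sq_nonneg (C x)]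

lemma abs_C_le_one (H : Lobe C S dS x₀) (x : ℝ) : |C x| ≤ 1 := by
  rw [abs_of_pos (H.C_pos x)]; exact H.C_le_one x

lemma abs_S_le_one (H : Lobe C S dS x₀) (x : ℝ) : |S x| ≤ 1 := by
  rw [abs_of_pos (H.S_pos x)]; exact H.S_le_one x

lemma monotoneOn (H : Lobe C S dS x₀) : MonotoneOn S (Set.Iic x₀) := by
  refine monotoneOn_of_deriv_nonneg (convex_Iic _) H.continuous_S.continuousOn
    (fun x _ => (H.hasDerivAt_S x).differentiableAt.differentiableWithinAt) fun x hx => ?_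
  rw [interior_Iic] at hx
  rw [(H.hasDerivAt_S x).deriv]
  exact H.dS_nonneg x hx

lemma S_le (H : Lobe C S dS x₀) (x : ℝ) : S x ≤ S x₀ := by
  rcases le_total x x₀ with h | h
  · exact H.monotoneOn h (Set.mem_Iic.2 le_rfl) h
  · have := H.reflect.monotoneOn (a := -x) (b := -x₀) (by simpa using h) (by simp) (by simpa using h)
    simpa using this

/-- The positive lower bound for `C` that turns `Im l > 0` into exponential rates. -/
lemma C_ge (H : Lobe C S dS x₀) (x : ℝ) : C x₀ ≤ C x := by
  nlinarith [H.sq_add_sq x, H.sq_add_sq x₀, H.S_le x, H.S_pos x, H.S_pos x₀, H.C_pos x, H.C_pos x₀]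

lemma hasDerivAt_cot (H : Lobe C S dS x₀) (x : ℝ) :
    HasDerivAt (fun x => C x / S x) (-(dS x / (C x * S x ^ 2))) x := by
  have hC := H.C_pos x
  have hS := H.S_pos x
  refine ((H.hasDerivAt_C x).div (H.hasDerivAt_S x) hS.ne').congr_deriv ?_
  have := H.sq_add_sq x
  field_simp
  linear_combination (-dS x) * this

end Lobe

/-- `exp (c x) h x` decreases up to `x₁`, and it starts from `0` at `-∞` since `h` has a finite
limit there. -/
lemma nonpos_of_deriv_le_neg_mul {h h' : ℝ → ℝ} {c x₁ : ℝ} (hc : 0 < c) {a : ℝ}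
    (hd : ∀ x, HasDerivAt h (h' x) x) (hle : ∀ x < x₁, h' x ≤ -c * h x)
    (hlim : Tendsto h atBot (𝓝 a)) : h x₁ ≤ 0 := by
  have hm : ∀ x, HasDerivAt (fun x => Real.exp (c * x) * h x)
      (Real.exp (c * x) * (h' x + c * h x)) x :=
    fun x => ((((hasDerivAt_id x).const_mul c).exp).mul (hd x)).congr_deriv (by simp; ring)
  have anti : AntitoneOn (fun x => Real.exp (c * x) * h x) (Set.Iic x₁) := by
    refine antitoneOn_of_deriv_nonpos (convex_Iic _)
      (fun x _ => (hm x).continuousAt.continuousWithinAt)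
      (fun x _ => (hm x).differentiableAt.differentiableWithinAt) fun x hx => ?_
    rw [interior_Iic] at hx
    rw [(hm x).deriv]
    exact mul_nonpos_of_nonneg_of_nonpos (Real.exp_pos _).le (by linarith [hle x hx])
  have hl : Tendsto (fun x => Real.exp (c * x) * h x) atBot (𝓝 (0 * a)) :=
    (Real.tendsto_exp_atBot.comp (tendsto_id.const_mul_atBot hc)).mul hlim
  rw [zero_mul] at hl
  have : Real.exp (c * x₁) * h x₁ ≤ 0 :=
    ge_of_tendsto hl ((eventually_le_atBot x₁).mono fun x hx =>
      anti hx (Set.mem_Iic.2 le_rfl) hx)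
  exact nonpos_of_mul_nonpos_right this (Real.exp_pos _)

lemma neg_of_deriv_neg {h h' : ℝ → ℝ} {x₁ : ℝ} (hd : ∀ x, HasDerivAt h (h' x) x)
    (hneg : ∀ x < x₁, h' x < 0) (hlim : Tendsto h atBot (𝓝 0)) : h x₁ < 0 := by
  have anti : StrictAntiOn h (Set.Iic x₁) := by
    refine strictAntiOn_of_deriv_neg (convex_Iic _)
      (fun x _ => (hd x).continuousAt.continuousWithinAt) fun x hx => ?_
    rw [interior_Iic] at hx
    rw [(hd x).deriv]
    exact hneg x hx
  have h1 : h x₁ < h (x₁ - 1) :=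
    anti (Set.mem_Iic.2 (by linarith)) (Set.mem_Iic.2 le_rfl) (by linarith)
  have h2 : h (x₁ - 1) ≤ 0 :=
    ge_of_tendsto hlim ((eventually_le_atBot (x₁ - 1)).mono fun x hx =>
      anti.antitoneOn (Set.mem_Iic.2 (hx.trans (by linarith))) (Set.mem_Iic.2 (by linarith)) hx)
  linarith

/-! ### Eigenvalues lie on the unit circle -/

namespace Sol

variable {C S dS : ℝ → ℝ} {x₀ : ℝ} {l m : ℂ} {f g : ℝ → ℂ}

/-- At `-∞` the recessive component of a decaying solution is of the order of `S`. -/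
lemma tendsto_cot_mul (h : Sol C S l m f g) (H : Lobe C S dS x₀) (hl : 0 < l.im)
    (hN : Tendsto (density f g) atBot (𝓝 0)) :
    Tendsto (fun x => C x / S x * Complex.normSq (g x)) atBot (𝓝 0) := by
  set c := l.im * C x₀ with hc
  have hcpos : 0 < c := mul_pos hl (H.C_pos x₀)
  -- The constant left over when the cross term of `(|g|²)'` is split as `2 S |m| |f| |g| ≤ c |g|² +
  -- |m|² S² / c`, with `|f| ≤ 1` near `-∞`.
  set K := Complex.normSq m / c ^ 2
  have hg : Tendsto (fun x => Complex.normSq (g x)) atBot (𝓝 0) :=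
    squeeze_zero (fun x => Complex.normSq_nonneg (g x))
      (fun x => le_add_of_nonneg_left (Complex.normSq_nonneg (f x))) hN
  have h1 : ∀ᶠ x₁ in atBot, Complex.normSq (g x₁) ≤ K * S x₁ ^ 2 := by
    obtain ⟨X, hX⟩ := eventually_atBot.1 (hN.eventually (ge_mem_nhds (zero_lt_one)))
    filter_upwards [eventually_le_atBot X, eventually_le_atBot x₀] with x₁ hx₁ hx₁'
    suffices hs : Complex.normSq (g x₁) - K * S x₁ ^ 2 ≤ 0 by linarith
    -- Freezing `S` at the right endpoint `x₁` avoids differentiating it; monotonicity of `S` to the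
    -- left of `x₀` gives `S x ≤ S x₁`.
    refine nonpos_of_deriv_le_neg_mul (h := fun x => Complex.normSq (g x) - K * S x₁ ^ 2) hcpos
      (fun x => (h.hasDerivAt_normSq_right x).sub_const _) (fun x hx => ?_) (hg.sub_const _)
    have hS := H.S_pos x
    have hSle : S x ≤ S x₁ := H.monotoneOn (hx.le.trans hx₁') hx₁' hx.le
    have hC := H.C_ge x
    have hf : Complex.normSq (f x) ≤ 1 :=
      le_trans (le_add_of_nonneg_right (Complex.normSq_nonneg _)) (hX x (hx.le.trans hx₁))
    have hKc : K * c ^ 2 = Complex.normSq m := div_mul_cancel₀ _ (by positivity)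
    have e1 : c * Complex.normSq (g x) ≤ l.im * C x * Complex.normSq (g x) := by
      have := Complex.normSq_nonneg (g x)
      rw [hc]; gcongr
    set r := m.re * ((f x).im * (g x).re - (f x).re * (g x).im)
          + m.im * ((f x).re * (g x).re + (f x).im * (g x).im) with hr
    have e2 : r ^ 2 ≤ Complex.normSq m * Complex.normSq (f x) * Complex.normSq (g x) := by
      rw [hr]; simp only [Complex.normSq_apply]
      nlinarith [sq_nonneg (m.im * ((f x).im * (g x).re - (f x).re * (g x).im)
          - m.re * ((f x).re * (g x).re + (f x).im * (g x).im))]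
    have e3 : c * (-2 * S x * r) ≤ c ^ 2 * Complex.normSq (g x) + Complex.normSq m * S x ^ 2 := by
      have hgn := Complex.normSq_nonneg (g x)
      have hmn := Complex.normSq_nonneg m
      have : r ^ 2 ≤ Complex.normSq m * Complex.normSq (g x) := by
        refine e2.trans ?_
        gcongr
        exact mul_le_of_le_one_right hmn hf
      have e4 : (c * (-2 * S x * r)) ^ 2
          ≤ (c ^ 2 * Complex.normSq (g x) + Complex.normSq m * S x ^ 2) ^ 2 := by
        have := mul_le_mul_of_nonneg_left this (by positivity : 0 ≤ 4 * c ^ 2 * S x ^ 2)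
        nlinarith [sq_nonneg (c ^ 2 * Complex.normSq (g x) - Complex.normSq m * S x ^ 2)]
      exact abs_le_of_sq_le_sq' e4 (by positivity) |>.2
    have e5 : Complex.normSq m * S x ^ 2 ≤ c * (c * (K * S x₁ ^ 2)) := by
      rw [show c * (c * (K * S x₁ ^ 2)) = K * c ^ 2 * S x₁ ^ 2 by ring, hKc]
      have := Complex.normSq_nonneg m
      gcongr
    have e6 : -2 * S x * r ≤ c * Complex.normSq (g x) + c * (K * S x₁ ^ 2) := by
      refine le_of_mul_le_mul_left ?_ hcpos
      nlinarith
    nlinarith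
  have hK : Tendsto (fun x => K * S x) atBot (𝓝 0) := by
    simpa using H.tendsto_bot.const_mul K
  refine squeeze_zero' (Eventually.of_forall fun x => ?_) (h1.mono fun x hx => ?_) hK
  · exact mul_nonneg (div_pos (H.C_pos x) (H.S_pos x)).le (Complex.normSq_nonneg _)
  · have hS := H.S_pos x
    calc C x / S x * Complex.normSq (g x) ≤ C x / S x * (K * S x ^ 2) :=
          mul_le_mul_of_nonneg_left hx (div_pos (H.C_pos x) hS).le
      _ = C x * (K * S x) := by field_simp
      _ ≤ 1 * (K * S x) := by
          have : 0 ≤ K := div_nonneg (Complex.normSq_nonneg _) (by positivity)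
          gcongr
          exact H.C_le_one x
      _ = K * S x := one_mul _

/-- If `Im m ≠ 0`, the sign of `Re (f conj g)` at the top of the lobe is dictated by the decay at
`-∞`. -/
lemma re_mul_conj_neg (h : Sol C S l m f g) (H : Lobe C S dS x₀) (hl : 0 < l.im)
    (hN : Tendsto (density f g) atBot (𝓝 0)) (hne : ∀ x, density f g x ≠ 0) {k : ℝ}
    (hk : k ≠ 0) (hk1 : |k| < 1) (him : m.im = k * l.im) (hre : l.re = k * m.re) :
    ((f x₀).re * (g x₀).re + (f x₀).im * (g x₀).im) / k < 0 := by
  set p : ℝ → ℝ := fun x => (f x).re * (g x).re + (f x).im * (g x).im with hp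
  -- The weight `C/S` is chosen so that `Im(f conj g)` drops out: it enters `p'/k` with coefficient
  -- `2 C Re l / k = 2 C Re m` and `(C/S)(|g|²)'` with the opposite one.
  have hd : ∀ x, HasDerivAt (fun x => p x / k + C x / S x * Complex.normSq (g x)) _ x :=
    fun x => ((h.hasDerivAt_re_mul_conj x).div_const k).add
      ((H.hasDerivAt_cot x).mul (h.hasDerivAt_normSq_right x))
  obtain ⟨hf0, hg0⟩ := tendsto_components hN
  have hp0 : Tendsto p atBot (𝓝 0) := by
    have : Tendsto (fun x => (f x * (starRingEnd ℂ) (g x)).re) atBot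
        (𝓝 (0 * (starRingEnd ℂ) 0 : ℂ).re) :=
      (Complex.continuous_re.tendsto _).comp
        (hf0.mul ((Complex.continuous_conj.tendsto _).comp hg0))
    simpa [hp] using this
  have hlim : Tendsto (fun x => p x / k + C x / S x * Complex.normSq (g x)) atBot (𝓝 0) := by
    simpa using (hp0.div_const k).add (h.tendsto_cot_mul H hl hN)
  have := neg_of_deriv_neg hd (x₁ := x₀) (fun x hx => ?_) hlim
  · have h2 : 0 ≤ C x₀ / S x₀ * Complex.normSq (g x₀) :=
      mul_nonneg (div_pos (H.C_pos x₀) (H.S_pos x₀)).le (Complex.normSq_nonneg _)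
    linarith
  · have hS := H.S_pos x
    have hC := H.C_pos x
    have hdS := H.dS_nonneg x hx
    have hpos : 0 < density f g x := lt_of_le_of_ne (density_nonneg _ _ _) (hne x).symm
    have ha := Complex.normSq_nonneg (f x)
    have hb := Complex.normSq_nonneg (g x)
    have hab : p x ^ 2 ≤ Complex.normSq (f x) * Complex.normSq (g x) := by
      simp only [hp, Complex.normSq_apply]
      nlinarith [sq_nonneg ((f x).re * (g x).im - (f x).im * (g x).re)]
    -- Cauchy-Schwarz and `k² ≤ 1` bound the cross term by `S²|f|² + C²|g|²`, leaving at least `(S²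
    -- + C²)|g|²`. Where `g = 0` the cross term vanishes and `S²|f|²` is positive.
    have key : 0 < S x ^ 2 * density f g x + 2 * C x ^ 2 * Complex.normSq (g x)
        + 2 * k * C x * S x * p x := by
      have h1 : |2 * k * C x * S x * p x|
          ≤ S x ^ 2 * Complex.normSq (f x) + C x ^ 2 * Complex.normSq (g x) := by
        refine abs_le_of_sq_le_sq ?_ (by positivity)
        have hk2 : k ^ 2 ≤ 1 := (sq_le_one_iff_abs_le_one k).2 hk1.le
        have : k ^ 2 * p x ^ 2 ≤ 1 * (Complex.normSq (f x) * Complex.normSq (g x)) := by gcongr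
        have := mul_le_mul_of_nonneg_left this (by positivity : 0 ≤ 4 * C x ^ 2 * S x ^ 2)
        nlinarith [sq_nonneg (S x ^ 2 * Complex.normSq (f x) - C x ^ 2 * Complex.normSq (g x))]
      have h2 := neg_abs_le (2 * k * C x * S x * p x)
      have hexp : density f g x = Complex.normSq (f x) + Complex.normSq (g x) := rfl
      rcases hb.eq_or_lt with hb0 | hb0
      · have hp1 : p x = 0 := by
          rw [← hb0, mul_zero] at hab
          exact pow_eq_zero_iff two_ne_zero |>.1 (le_antisymm hab (sq_nonneg _))
        rw [hp1, ← hb0]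
        have := mul_pos (pow_pos hS 2) hpos
        linarith
      · have := mul_pos (pow_pos hS 2) hb0
        have := mul_nonneg (sq_nonneg (C x)) hb
        rw [hexp]
        linarith
    have hkey : 0 < l.im * (S x ^ 2 * density f g x + 2 * C x ^ 2 * Complex.normSq (g x)
        + 2 * k * C x * S x * p x) / S x := div_pos (mul_pos hl key) hS
    have hQ : 0 ≤ dS x / (C x * S x ^ 2) * Complex.normSq (g x) := by positivity
    have : 0 < l.im * (S x ^ 2 * density f g x + 2 * C x ^ 2 * Complex.normSq (g x)
        + 2 * k * C x * S x * p x) / S x + dS x / (C x * S x ^ 2) * Complex.normSq (g x) := by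
      linarith
    rw [← neg_neg_iff_pos] at this
    convert this using 1
    rw [hre, him]
    simp only [hp]
    field_simp
    ring

/-- A decaying solution forces `Im m = 0`. -/
lemma im_eq_zero (h : Sol C S l m f g) (H : Lobe C S dS x₀) (hl : 0 < l.im)
    (hlm : m ^ 2 - l ^ 2 = 1 / 4)
    (hbot : Tendsto (density f g) atBot (𝓝 0)) (htop : Tendsto (density f g) atTop (𝓝 0))
    (hne : ∀ x, density f g x ≠ 0) : m.im = 0 ∧ l.re = 0 := by
  have e1 := congrArg Complex.re hlm
  have e2 := congrArg Complex.im hlm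
  simp [pow_two] at e1 e2
  set k := m.im / l.im with hk
  have him : m.im = k * l.im := by rw [hk]; field_simp
  have hre : l.re = k * m.re := by rw [hk]; field_simp; linarith
  -- The real part of `m² - l² = 1/4` is `(1 - k²)((Re m)² + (Im l)²) = 1/4`.
  have hk1 : |k| < 1 := by
    rw [← sq_lt_one_iff_abs_lt_one]
    rw [him, hre] at e1
    by_contra! hcon
    nlinarith [mul_nonneg (sub_nonneg.2 hcon) (add_nonneg (sq_nonneg m.re) (sq_nonneg l.im))]
  by_cases hk0 : k = 0
  · simp [him, hre, hk0]
  exfalso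
  have h1 := h.re_mul_conj_neg H hl hbot hne hk0 hk1 him hre
  have hsym : ∀ x, density (fun x => g (-x)) (fun x => f (-x)) x = density f g (-x) :=
    fun x => add_comm _ _
  have h2 := h.reflect.re_mul_conj_neg H.reflect hl (k := -k)
    (by rw [funext hsym]; exact htop.comp tendsto_neg_atBot_atTop)
    (fun x => by rw [hsym]; exact hne _) (neg_ne_zero.2 hk0) (by rwa [abs_neg])
    (by simp [him]) (by simp [hre])
  simp only [neg_neg, div_neg] at h2
  have : ((g x₀).re * (f x₀).re + (g x₀).im * (f x₀).im) / k
    = ((f x₀).re * (g x₀).re + (f x₀).im * (g x₀).im) / k := by ring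
  linarith

/-- There are no decaying solutions for real parameters. -/
lemma im_ne_zero (h : Sol C S l m f g)
    (hbot : Tendsto (density f g) atBot (𝓝 0)) (hne : ∀ x, density f g x ≠ 0)
    (hm : m.im = 0) : l.im ≠ 0 := by
  intro hl
  have h1 : ∀ x y, density f g x = density f g y := is_const_of_deriv_eq_zero
    (fun x => (h.hasDerivAt_density x).differentiableAt)
    fun x => (h.hasDerivAt_density x).deriv.trans (by simp [hl, hm])
  have h2 : density f g = fun _ => density f g 0 := funext fun x => h1 x 0
  rw [h2] at hbot
  exact hne 0 (tendsto_nhds_unique tendsto_const_nhds hbot)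

end Sol
end SineGordon
-- Positivity of the quadratic form behind the derivative of the Wronskian
namespace SineGordon

lemma hasDerivAt_integral_Iic {E : Type*} [NormedAddCommGroup E] [NormedSpace ℝ E]
    [CompleteSpace E] {F : ℝ → E} (hF : Continuous F)
    (hi : ∀ x, IntegrableOn F (Set.Iic x)) (x : ℝ) :
    HasDerivAt (fun x => ∫ y in Set.Iic x, F y) (F x) x := by
  have h1 : (fun x => ∫ y in Set.Iic x, F y)
      = fun x => (∫ y in Set.Iic (0 : ℝ), F y) + ∫ y in (0 : ℝ)..x, F y := by
    funext x
    rw [← intervalIntegral.integral_Iic_sub_Iic (hi 0) (hi x)]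
    abel
  rw [h1]
  exact (intervalIntegral.integral_hasDerivAt_right (hF.intervalIntegrable _ _)
    (hF.stronglyMeasurableAtFilter _ _) hF.continuousAt).const_add _

lemma tendsto_integral_Iic_atBot {E : Type*} [NormedAddCommGroup E] [NormedSpace ℝ E]
    {F : ℝ → E} (hi : Integrable F) :
    Tendsto (fun x => ∫ y in Set.Iic x, F y) atBot (𝓝 0) := by
  have h1 : ∀ x, ∫ y in Set.Iic x, F y = ∫ y, (Set.Iic x).indicator F y :=
    fun x => (integral_indicator measurableSet_Iic).symm
  simp_rw [h1]
  rw [← integral_zero ℝ E (μ := volume)]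
  refine tendsto_integral_filter_of_dominated_convergence (fun y => ‖F y‖)
    (Eventually.of_forall fun x => hi.aestronglyMeasurable.indicator measurableSet_Iic)
    (Eventually.of_forall fun x => Eventually.of_forall fun y => norm_indicator_le_norm_self _ _)
    hi.norm (Eventually.of_forall fun y => ?_)
  refine tendsto_const_nhds.congr' ?_
  filter_upwards [eventually_lt_atBot y] with x hx
  rw [Set.indicator_of_notMem]
  simpa using hx

namespace Sol

variable {C S dS : ℝ → ℝ} {x₀ : ℝ} {f h : ℝ → ℝ} {A B : ℝ}

/-- The quadratic form whose integral is the `z`-derivative of the Wronskian, for a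
solution `(f, i h)` with `f`, `h` real. -/
def form (C S f h : ℝ → ℝ) (A B : ℝ) (x : ℝ) : ℝ :=
  2 * B * C x * f x * h x + A * S x * (f x ^ 2 + h x ^ 2)

lemma form_reflect (C S f h : ℝ → ℝ) (A B x : ℝ) :
    form (fun x => C (-x)) (fun x => S (-x)) (fun x => h (-x)) (fun x => f (-x)) A B x
      = form C S f h A B (-x) := by
  simp only [form]; ring

lemma continuous_form (hC : Continuous C) (hS : Continuous S) (hf : Continuous f)
    (hh : Continuous h) : Continuous (form C S f h A B) := by
  unfold form; fun_prop

lemma ofReal {A B : ℝ} {p q : ℝ → ℝ}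
    (hp : ∀ x, HasDerivAt p (A * C x * p x - B * S x * q x) x)
    (hq : ∀ x, HasDerivAt q (B * S x * p x - A * C x * q x) x) :
    Sol C S (A * Complex.I) B (fun x => p x) (fun x => q x * Complex.I) := by
  refine ⟨fun x => (hp x).ofReal_comp.congr_deriv ?_,
    fun x => ((hq x).ofReal_comp.mul_const Complex.I).congr_deriv ?_⟩
  · push_cast
    linear_combination (A * C x * p x - B * S x * q x : ℂ) * Complex.I_sq
  · push_cast
    linear_combination -(A * C x * q x * Complex.I : ℂ) * Complex.I_sq

lemma density_ofReal (p q : ℝ → ℝ) :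
    density (fun x => (p x : ℂ)) (fun x => q x * Complex.I) = fun x => p x ^ 2 + q x ^ 2 := by
  funext x; simp [density, Complex.normSq_apply]; ring

/-- Subtracting the form from the derivative of `(C/S) h²` cancels the indefinite term `2 B C f h`,
whatever the sign of `B`. What remains is strictly negative to the left of `x₀`, so the integral
strictly exceeds `(C/S) h² ≥ 0` at `x₀`. -/
lemma integral_form_Iic_pos (hA : 0 < A) (H : Lobe C S dS x₀)
    (hf : ∀ x, HasDerivAt f (A * C x * f x - B * S x * h x) x)
    (hh : ∀ x, HasDerivAt h (B * S x * f x - A * C x * h x) x)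
    (hN : Tendsto (fun x => f x ^ 2 + h x ^ 2) atBot (𝓝 0))
    (hne : ∀ x, f x ^ 2 + h x ^ 2 ≠ 0) (hi : Integrable (form C S f h A B)) :
    0 < ∫ x in Set.Iic x₀, form C S f h A B x := by
  have hfc : Continuous f := continuous_iff_continuousAt.2 fun x => (hf x).continuousAt
  have hhc : Continuous h := continuous_iff_continuousAt.2 fun x => (hh x).continuousAt
  have hsol := ofReal hf hh
  have hden := density_ofReal f h
  have hQ := hsol.tendsto_cot_mul H (by simpa using hA) (by rw [hden]; exact hN)
  have hnq : ∀ x, Complex.normSq (h x * Complex.I) = h x ^ 2 := fun x => by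
    simp [Complex.normSq_apply]; ring
  simp only [hnq] at hQ
  have hd : ∀ x, HasDerivAt (fun x => C x / S x * h x ^ 2 - ∫ y in Set.Iic x, form C S f h A B y)
      _ x :=
    fun x => ((H.hasDerivAt_cot x).mul ((hh x).pow 2)).sub (hasDerivAt_integral_Iic
      (continuous_form H.continuous_C H.continuous_S hfc hhc) (fun x => hi.integrableOn) x)
  have := neg_of_deriv_neg hd (x₁ := x₀) (fun x hx => ?_)
    (by simpa using hQ.sub (tendsto_integral_Iic_atBot hi))
  · have h2 : 0 ≤ C x₀ / S x₀ * h x₀ ^ 2 :=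
      mul_nonneg (div_pos (H.C_pos x₀) (H.S_pos x₀)).le (sq_nonneg _)
    linarith
  · have hS := H.S_pos x
    have hC := H.C_pos x
    have hdS := H.dS_nonneg x hx
    have hpos : 0 < f x ^ 2 + h x ^ 2 := lt_of_le_of_ne (by positivity) (hne x).symm
    have h1 : 0 < A * (2 * C x ^ 2 / S x * h x ^ 2) + A * S x * (f x ^ 2 + h x ^ 2)
      + dS x / (C x * S x ^ 2) * h x ^ 2 := by positivity
    rw [← neg_neg_iff_pos] at h1
    convert h1 using 1
    simp only [form, Pi.pow_apply]
    field_simp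
    ring

lemma integral_form_pos (hA : 0 < A) (H : Lobe C S dS x₀)
    (hf : ∀ x, HasDerivAt f (A * C x * f x - B * S x * h x) x)
    (hh : ∀ x, HasDerivAt h (B * S x * f x - A * C x * h x) x)
    (hbot : Tendsto (fun x => f x ^ 2 + h x ^ 2) atBot (𝓝 0))
    (htop : Tendsto (fun x => f x ^ 2 + h x ^ 2) atTop (𝓝 0))
    (hne : ∀ x, f x ^ 2 + h x ^ 2 ≠ 0) (hi : Integrable (form C S f h A B)) :
    0 < ∫ x, form C S f h A B x := by
  have h1 := integral_form_Iic_pos hA H hf hh hbot hne hi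
  have h2 := integral_form_Iic_pos (f := fun x => h (-x)) (h := fun x => f (-x)) (B := B) hA
    H.reflect
    (fun x => ((hh (-x)).scomp x (hasDerivAt_neg x)).congr_deriv (by simp))
    (fun x => ((hf (-x)).scomp x (hasDerivAt_neg x)).congr_deriv (by simp))
    (by simpa only [Function.comp_def, add_comm] using htop.comp tendsto_neg_atBot_atTop)
    (fun x => by rw [add_comm]; exact hne (-x))
    (by simpa only [funext (form_reflect C S f h A B)] using hi.comp_neg)
  simp only [form_reflect] at h2
  rw [integral_comp_neg_Iic (-x₀) (form C S f h A B), neg_neg] at h2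
  rw [← intervalIntegral.integral_Iic_add_Ioi hi.integrableOn hi.integrableOn (b := x₀)]
  exact add_pos h1 h2

end Sol
end SineGordon
-- Volterra operators and the exponential weight
namespace SineGordon

/-- `∫₀ˣ C`. -/
noncomputable def phase (C : ℝ → ℝ) (x : ℝ) : ℝ := ∫ y in (0 : ℝ)..x, C y

/-- `∫_{-∞}ˣ S`. -/
noncomputable def cumulative (S : ℝ → ℝ) (x : ℝ) : ℝ := ∫ y in Set.Iic x, S y

/-- The Volterra operator solving `V' = 2 i l C V + S h`, `V(-∞) = 0`. -/
noncomputable def volterra (C S : ℝ → ℝ) (l : ℂ) (h : ℝ → ℂ) (x : ℝ) : ℂ :=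
  ∫ y in Set.Iic x, Complex.exp (2 * Complex.I * l * (phase C x - phase C y : ℝ)) * (S y * h y)

lemma norm_exp_two_I_mul (l : ℂ) (t : ℝ) :
    ‖Complex.exp (2 * Complex.I * l * (t : ℝ))‖ = Real.exp (-(2 * l.im * t)) := by
  rw [Complex.norm_exp]; simp

lemma norm_exp_two_I_mul_le_one {l : ℂ} (hl : 0 ≤ l.im) {t : ℝ} (ht : 0 ≤ t) :
    ‖Complex.exp (2 * Complex.I * l * (t : ℝ))‖ ≤ 1 := by
  rw [norm_exp_two_I_mul, Real.exp_le_one_iff]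
  have := mul_nonneg hl ht
  linarith

/-- Both exponents lie in the half-plane `Re w ≤ -(Im l₀) t`, since `Im l ≥ Im l₀ / 2`. The mean
value inequality there gives `2 t exp(-(Im l₀) t) ‖l - l₀‖`, and the exponential absorbs `t`; the
bound is thus uniform in `t`. -/
lemma norm_exp_sub_exp_le {l₀ l : ℂ} (h₀ : 0 < l₀.im) (hl : ‖l - l₀‖ ≤ l₀.im / 2) {t : ℝ}
    (ht : 0 ≤ t) :
    ‖Complex.exp (2 * Complex.I * l * (t : ℝ)) - Complex.exp (2 * Complex.I * l₀ * (t : ℝ))‖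
      ≤ 2 / l₀.im * ‖l - l₀‖ := by
  set η := l₀.im
  have him : η / 2 ≤ l.im := by
    have h1 := (abs_le.1 ((Complex.abs_im_le_norm (l - l₀)).trans hl)).1
    rw [Complex.sub_im] at h1
    linarith
  have hconv : Convex ℝ {w : ℂ | w.re ≤ -(η * t)} := convex_halfSpace_re_le _
  have h1 := hconv.norm_image_sub_le_of_norm_deriv_le (𝕜 := ℂ) (f := Complex.exp)
    (C := Real.exp (-(η * t))) (x := 2 * Complex.I * l₀ * (t : ℝ)) (y := 2 * Complex.I * l * (t : ℝ))
    (fun w _ => Complex.differentiableAt_exp)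
    (fun w hw => by
      rw [Complex.deriv_exp, Complex.norm_exp]
      exact Real.exp_le_exp.2 hw)
    (by
      simp only [Set.mem_ofPred_eq]
      simp
      nlinarith)
    (by
      simp only [Set.mem_ofPred_eq]
      simp
      nlinarith)
  refine h1.trans ?_
  have h2 : ‖2 * Complex.I * l * (t : ℝ) - 2 * Complex.I * l₀ * (t : ℝ)‖ = 2 * t * ‖l - l₀‖ := by
    rw [show 2 * Complex.I * l * (t : ℝ) - 2 * Complex.I * l₀ * (t : ℝ)
      = Complex.I * ((2 * t : ℝ) * (l - l₀)) by push_cast; ring]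
    rw [norm_mul, norm_mul, Complex.norm_I, one_mul, Complex.norm_real, Real.norm_of_nonneg
      (by positivity)]
  rw [h2]
  have h3 : η * t ≤ Real.exp (η * t) := by linarith [Real.add_one_le_exp (η * t)]
  have h4 : Real.exp (-(η * t)) * t ≤ 1 / η := by
    rw [Real.exp_neg, ← div_eq_inv_mul, div_le_div_iff₀ (Real.exp_pos _) h₀]
    linarith
  calc _ = (Real.exp (-(η * t)) * t) * (2 * ‖l - l₀‖) := by ring
    _ ≤ 1 / η * (2 * ‖l - l₀‖) := by gcongr
    _ = _ := by ring

namespace Lobe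

variable {C S dS : ℝ → ℝ} {x₀ : ℝ}

lemma hasDerivAt_phase (H : Lobe C S dS x₀) (x : ℝ) : HasDerivAt (phase C) (C x) x :=
  intervalIntegral.integral_hasDerivAt_right (H.continuous_C.intervalIntegrable _ _)
    (H.continuous_C.stronglyMeasurableAtFilter _ _) H.continuous_C.continuousAt

lemma continuous_phase (H : Lobe C S dS x₀) : Continuous (phase C) :=
  continuous_iff_continuousAt.2 fun x => (H.hasDerivAt_phase x).continuousAt

lemma monotone_phase (H : Lobe C S dS x₀) : Monotone (phase C) :=
  monotone_of_hasDerivAt_nonneg H.hasDerivAt_phase fun x => (H.C_pos x).le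

lemma phase_le (H : Lobe C S dS x₀) {x : ℝ} (hx : x ≤ 0) : phase C x ≤ C x₀ * x := by
  have hd : ∀ x, HasDerivAt (fun x => phase C x - C x₀ * x) (C x - C x₀) x := fun x =>
    ((H.hasDerivAt_phase x).sub ((hasDerivAt_id x).const_mul (C x₀))).congr_deriv (by simp)
  have := monotone_of_hasDerivAt_nonneg hd (fun x => sub_nonneg.2 (H.C_ge x)) hx
  simp [phase] at this
  simpa [phase] using this

lemma tendsto_phase (H : Lobe C S dS x₀) : Tendsto (phase C) atBot atBot :=
  tendsto_atBot_mono' _ ((eventually_le_atBot 0).mono fun _ hx => H.phase_le hx)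
    (tendsto_id.const_mul_atBot (H.C_pos x₀))

lemma hasDerivAt_cumulative (H : Lobe C S dS x₀) (x : ℝ) :
    HasDerivAt (cumulative S) (S x) x :=
  hasDerivAt_integral_Iic H.continuous_S (fun _ => H.integrable.integrableOn) x

lemma continuous_cumulative (H : Lobe C S dS x₀) : Continuous (cumulative S) :=
  continuous_iff_continuousAt.2 fun x => (H.hasDerivAt_cumulative x).continuousAt

lemma tendsto_cumulative (H : Lobe C S dS x₀) : Tendsto (cumulative S) atBot (𝓝 0) :=
  tendsto_integral_Iic_atBot H.integrable

lemma cumulative_nonneg (H : Lobe C S dS x₀) (x : ℝ) : 0 ≤ cumulative S x :=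
  integral_nonneg fun y => (H.S_pos y).le

lemma cumulative_le (H : Lobe C S dS x₀) (x : ℝ) : cumulative S x ≤ ∫ y, S y :=
  setIntegral_le_integral H.integrable (Eventually.of_forall fun y => (H.S_pos y).le)

lemma integrable_mul (H : Lobe C S dS x₀) {h : ℝ → ℂ} (hh : Continuous h) {M : ℝ}
    (hM : ∀ x, ‖h x‖ ≤ M) : Integrable fun y => (S y : ℂ) * h y := by
  refine (H.integrable.mul_const M).mono'
    ((Complex.continuous_ofReal.comp H.continuous_S).mul hh).aestronglyMeasurable
    (Eventually.of_forall fun y => ?_)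
  rw [norm_mul, Complex.norm_real, Real.norm_of_nonneg (H.S_pos y).le]
  exact mul_le_mul_of_nonneg_left (hM y) (H.S_pos y).le

lemma integrableOn_kernel (H : Lobe C S dS x₀) {l : ℂ} (hl : 0 ≤ l.im) {h : ℝ → ℂ}
    (hh : Continuous h) {M : ℝ} (hM : ∀ x, ‖h x‖ ≤ M) (x : ℝ) :
    IntegrableOn (fun y => Complex.exp (2 * Complex.I * l * (phase C x - phase C y : ℝ))
      * (S y * h y)) (Set.Iic x) := by
  have hi := (H.integrable_mul hh hM).norm.integrableOn (s := Set.Iic x)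
  have hp := H.continuous_phase
  have hS := H.continuous_S
  refine hi.mono' (Continuous.aestronglyMeasurable (by fun_prop)) ?_
  refine (ae_restrict_iff' measurableSet_Iic).2 (Eventually.of_forall fun y hy => ?_)
  rw [norm_mul]
  exact mul_le_of_le_one_left (norm_nonneg _)
    (norm_exp_two_I_mul_le_one hl (sub_nonneg.2 (H.monotone_phase hy)))

lemma hasDerivAt_volterra (H : Lobe C S dS x₀) {l : ℂ} (hl : 0 ≤ l.im) {h : ℝ → ℂ}
    (hh : Continuous h) {M : ℝ} (hM : ∀ x, ‖h x‖ ≤ M) (x : ℝ) :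
    HasDerivAt (volterra C S l h)
      (2 * Complex.I * l * C x * volterra C S l h x + S x * h x) x := by
  have hp := H.continuous_phase
  have hS := H.continuous_S
  -- Factoring the kernel removes `x` from the integrand, so that the fundamental theorem of
  -- calculus applies.
  have hsplit : ∀ x y, Complex.exp (2 * Complex.I * l * (phase C x - phase C y : ℝ))
      * (S y * h y) = Complex.exp (2 * Complex.I * l * phase C x)
        * (Complex.exp (-(2 * Complex.I * l * phase C y)) * (S y * h y)) := by
    intro x y
    rw [← mul_assoc (Complex.exp _) (Complex.exp _), ← Complex.exp_add]
    congr 2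
    push_cast; ring
  have heq : volterra C S l h = fun x => Complex.exp (2 * Complex.I * l * phase C x)
      * ∫ y in Set.Iic x, Complex.exp (-(2 * Complex.I * l * phase C y)) * (S y * h y) := by
    funext x
    rw [← integral_const_mul]
    simp only [volterra, hsplit]
  have hi : ∀ x, IntegrableOn (fun y => Complex.exp (-(2 * Complex.I * l * phase C y))
      * (S y * h y)) (Set.Iic x) := by
    intro x
    refine ((H.integrableOn_kernel hl hh hM x).const_mul
      (Complex.exp (-(2 * Complex.I * l * phase C x)))).congr (Eventually.of_forall fun y => ?_)
    simp only [hsplit]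
    rw [← mul_assoc (Complex.exp _) (Complex.exp _), ← Complex.exp_add]
    simp
  have hd := ((((H.hasDerivAt_phase x).ofReal_comp.const_mul (2 * Complex.I * l)).cexp).mul
    (hasDerivAt_integral_Iic (by fun_prop) hi x))
  rw [heq]
  refine hd.congr_deriv ?_
  have he : Complex.exp (2 * Complex.I * l * phase C x)
      * Complex.exp (-(2 * Complex.I * l * phase C x)) = 1 := by
    rw [← Complex.exp_add]; simp
  linear_combination (S x * h x : ℂ) * he

lemma norm_volterra_sub_le (H : Lobe C S dS x₀) {l l' : ℂ} (hl : 0 ≤ l.im) (hl' : 0 ≤ l'.im)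
    {h : ℝ → ℂ} (hh : Continuous h) {M : ℝ} (hM : ∀ x, ‖h x‖ ≤ M) {δ : ℝ}
    (hδ : ∀ t : ℝ, 0 ≤ t → ‖Complex.exp (2 * Complex.I * l * (t : ℝ))
      - Complex.exp (2 * Complex.I * l' * (t : ℝ))‖ ≤ δ) (x : ℝ) :
    ‖volterra C S l h x - volterra C S l' h x‖ ≤ δ * ∫ y in Set.Iic x, S y * ‖h y‖ := by
  unfold volterra
  rw [← integral_sub (H.integrableOn_kernel hl hh hM x) (H.integrableOn_kernel hl' hh hM x),
    ← integral_const_mul]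
  have hn : ∀ y, ‖(S y : ℂ) * h y‖ = S y * ‖h y‖ := fun y => by
    rw [norm_mul, Complex.norm_real, Real.norm_of_nonneg (H.S_pos y).le]
  refine norm_integral_le_of_norm_le ?_ ?_
  · have := (H.integrable_mul hh hM).norm.const_mul δ
    simp only [hn] at this
    exact this.integrableOn
  · refine (ae_restrict_iff' measurableSet_Iic).2 (Eventually.of_forall fun y hy => ?_)
    rw [← sub_mul, norm_mul, hn]
    exact mul_le_mul_of_nonneg_right (hδ _ (sub_nonneg.2 (H.monotone_phase hy)))
      (mul_nonneg (H.S_pos y).le (norm_nonneg _))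

lemma norm_volterra_le (H : Lobe C S dS x₀) {l : ℂ} (hl : 0 ≤ l.im)
    {h : ℝ → ℂ} (hh : Continuous h) {M : ℝ} (hM : ∀ x, ‖h x‖ ≤ M) (x : ℝ) :
    ‖volterra C S l h x‖ ≤ ∫ y in Set.Iic x, S y * ‖h y‖ := by
  unfold volterra
  have hn : ∀ y, ‖(S y : ℂ) * h y‖ = S y * ‖h y‖ := fun y => by
    rw [norm_mul, Complex.norm_real, Real.norm_of_nonneg (H.S_pos y).le]
  refine norm_integral_le_of_norm_le ?_ ?_
  · have := (H.integrable_mul hh hM).norm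
    simp only [hn] at this
    exact this.integrableOn
  · refine (ae_restrict_iff' measurableSet_Iic).2 (Eventually.of_forall fun y hy => ?_)
    rw [norm_mul, hn]
    exact mul_le_of_le_one_left (mul_nonneg (H.S_pos y).le (norm_nonneg _))
      (norm_exp_two_I_mul_le_one hl (sub_nonneg.2 (H.monotone_phase hy)))

lemma volterra_sub (H : Lobe C S dS x₀) {l : ℂ} (hl : 0 ≤ l.im)
    {h h' : ℝ → ℂ} (hh : Continuous h) {M : ℝ} (hM : ∀ x, ‖h x‖ ≤ M)
    (hh' : Continuous h') {M' : ℝ} (hM' : ∀ x, ‖h' x‖ ≤ M') (x : ℝ) :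
    volterra C S l (fun x => h x - h' x) x = volterra C S l h x - volterra C S l h' x := by
  unfold volterra
  rw [← integral_sub (H.integrableOn_kernel hl hh hM x) (H.integrableOn_kernel hl hh' hM' x)]
  congr 1
  funext y
  ring

lemma integrable_mul_exp_cumulative (H : Lobe C S dS x₀) {K : ℝ} (hK : 0 < K) :
    Integrable fun y => S y * Real.exp (K * cumulative S y) := by
  have hc := H.continuous_cumulative
  refine (H.integrable.mul_const (Real.exp (K * ∫ y, S y))).mono'
    (H.continuous_S.mul (by fun_prop)).aestronglyMeasurable (Eventually.of_forall fun y => ?_)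
  have := H.S_pos y
  rw [Real.norm_of_nonneg (by positivity)]
  have := H.cumulative_le y
  gcongr

/-- The integrand is the derivative of `exp (K ∫ S) / K`. The gain `1/K` is the reason for the
weight: it makes the Volterra operators small on the whole line. -/
lemma integral_mul_exp_cumulative_le (H : Lobe C S dS x₀) {K : ℝ} (hK : 0 < K) (x : ℝ) :
    ∫ y in Set.Iic x, S y * Real.exp (K * cumulative S y) ≤ Real.exp (K * cumulative S x) / K := by
  have hd : ∀ y, HasDerivAt (fun y => Real.exp (K * cumulative S y) / K)
      (S y * Real.exp (K * cumulative S y)) y := fun y =>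
    (((H.hasDerivAt_cumulative y).const_mul K).exp.div_const K).congr_deriv (by field_simp)
  have hi := H.integrable_mul_exp_cumulative hK
  have hl : Tendsto (fun y => Real.exp (K * cumulative S y) / K) atBot (𝓝 (1 / K)) := by
    have := ((Real.continuous_exp.tendsto _).comp (H.tendsto_cumulative.const_mul K)).div_const K
    simpa using this
  rw [integral_Iic_of_hasDerivAt_of_tendsto' (fun y _ => hd y) hi.integrableOn hl]
  have : 0 < 1 / K := by positivity
  linarith

end Lobe

/-- The Volterra operator conjugated by the weight `exp (K ∫_{-∞}ˣ S)`. -/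
noncomputable def weightedVolterra (C S : ℝ → ℝ) (K : ℝ) (l : ℂ) (h : ℝ → ℂ) (x : ℝ) : ℂ :=
  (Real.exp (-(K * cumulative S x)) : ℂ)
    * volterra C S l (fun y => (Real.exp (K * cumulative S y) : ℂ) * h y) x

namespace Lobe

variable {C S dS : ℝ → ℝ} {x₀ : ℝ} {K : ℝ}

lemma continuous_weight_mul (H : Lobe C S dS x₀) (K : ℝ) {h : ℝ → ℂ} (hh : Continuous h) :
    Continuous fun y => (Real.exp (K * cumulative S y) : ℂ) * h y := by
  have := H.continuous_cumulative
  fun_prop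

lemma norm_weight_mul_le (H : Lobe C S dS x₀) (hK : 0 < K) {h : ℝ → ℂ} {M : ℝ}
    (hM : ∀ x, ‖h x‖ ≤ M) (x : ℝ) :
    ‖(Real.exp (K * cumulative S x) : ℂ) * h x‖ ≤ Real.exp (K * ∫ y, S y) * M := by
  rw [norm_mul, Complex.norm_real, Real.norm_of_nonneg (Real.exp_pos _).le]
  have := H.cumulative_le x
  have := hM x
  gcongr

lemma integral_weight_le (H : Lobe C S dS x₀) (hK : 0 < K) {h : ℝ → ℂ} {M : ℝ}
    (hM : ∀ x, ‖h x‖ ≤ M) (x : ℝ) :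
    Real.exp (-(K * cumulative S x))
      * ∫ y in Set.Iic x, S y * ‖(Real.exp (K * cumulative S y) : ℂ) * h y‖ ≤ M / K := by
  have hM0 : 0 ≤ M := (norm_nonneg _).trans (hM 0)
  have h1 : ∫ y in Set.Iic x, S y * ‖(Real.exp (K * cumulative S y) : ℂ) * h y‖
      ≤ ∫ y in Set.Iic x, S y * Real.exp (K * cumulative S y) * M := by
    refine integral_mono_of_nonneg (Eventually.of_forall fun y =>
      mul_nonneg (H.S_pos y).le (norm_nonneg _)) ?_ (Eventually.of_forall fun y => ?_)
    · exact ((H.integrable_mul_exp_cumulative hK).mul_const M).integrableOn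
    · have := H.S_pos y
      have := hM y
      simp only
      rw [norm_mul, Complex.norm_real, Real.norm_of_nonneg (Real.exp_pos _).le, ← mul_assoc]
      gcongr
  rw [integral_mul_const] at h1
  calc _ ≤ Real.exp (-(K * cumulative S x)) * (Real.exp (K * cumulative S x) / K * M) := by
        refine mul_le_mul_of_nonneg_left (h1.trans ?_) (Real.exp_pos _).le
        have := H.integral_mul_exp_cumulative_le hK x
        gcongr
    _ = M / K := by
        rw [Real.exp_neg]
        have := (Real.exp_pos (K * cumulative S x)).ne'
        field_simp

lemma norm_weightedVolterra_le (H : Lobe C S dS x₀) (hK : 0 < K) {l : ℂ} (hl : 0 ≤ l.im)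
    {h : ℝ → ℂ} (hh : Continuous h) {M : ℝ} (hM : ∀ x, ‖h x‖ ≤ M) (x : ℝ) :
    ‖weightedVolterra C S K l h x‖ ≤ M / K := by
  unfold weightedVolterra
  rw [norm_mul, Complex.norm_real, Real.norm_of_nonneg (Real.exp_pos _).le]
  exact (mul_le_mul_of_nonneg_left (H.norm_volterra_le hl (H.continuous_weight_mul K hh)
    (H.norm_weight_mul_le hK hM) x) (Real.exp_pos _).le).trans (H.integral_weight_le hK hM x)

lemma norm_weightedVolterra_sub_le (H : Lobe C S dS x₀) (hK : 0 < K) {l l' : ℂ}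
    (hl : 0 ≤ l.im) (hl' : 0 ≤ l'.im) {h : ℝ → ℂ} (hh : Continuous h) {M : ℝ}
    (hM : ∀ x, ‖h x‖ ≤ M) {δ : ℝ}
    (hδ : ∀ t : ℝ, 0 ≤ t → ‖Complex.exp (2 * Complex.I * l * (t : ℝ))
      - Complex.exp (2 * Complex.I * l' * (t : ℝ))‖ ≤ δ) (x : ℝ) :
    ‖weightedVolterra C S K l h x - weightedVolterra C S K l' h x‖ ≤ δ * (M / K) := by
  have hδ0 : 0 ≤ δ := (norm_nonneg _).trans (hδ 0 le_rfl)
  unfold weightedVolterra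
  rw [← mul_sub, norm_mul, Complex.norm_real, Real.norm_of_nonneg (Real.exp_pos _).le]
  refine (mul_le_mul_of_nonneg_left (H.norm_volterra_sub_le hl hl' (H.continuous_weight_mul K hh)
    (H.norm_weight_mul_le hK hM) hδ x) (Real.exp_pos _).le).trans ?_
  rw [mul_left_comm]
  exact mul_le_mul_of_nonneg_left (H.integral_weight_le hK hM x) hδ0

lemma weightedVolterra_sub (H : Lobe C S dS x₀) (hK : 0 < K) {l : ℂ} (hl : 0 ≤ l.im)
    {h h' : ℝ → ℂ} (hh : Continuous h) {M : ℝ} (hM : ∀ x, ‖h x‖ ≤ M)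
    (hh' : Continuous h') {M' : ℝ} (hM' : ∀ x, ‖h' x‖ ≤ M') (x : ℝ) :
    weightedVolterra C S K l (fun x => h x - h' x) x
      = weightedVolterra C S K l h x - weightedVolterra C S K l h' x := by
  unfold weightedVolterra
  simp only [mul_sub]
  rw [H.volterra_sub hl (H.continuous_weight_mul K hh) (H.norm_weight_mul_le hK hM)
    (H.continuous_weight_mul K hh') (H.norm_weight_mul_le hK hM')]
  ring

lemma continuous_weightedVolterra (H : Lobe C S dS x₀) (hK : 0 < K) {l : ℂ} (hl : 0 ≤ l.im)
    {h : ℝ → ℂ} (hh : Continuous h) {M : ℝ} (hM : ∀ x, ‖h x‖ ≤ M) :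
    Continuous (weightedVolterra C S K l h) := by
  have h1 : Continuous (volterra C S l fun y => (Real.exp (K * cumulative S y) : ℂ) * h y) :=
    continuous_iff_continuousAt.2 fun x => (H.hasDerivAt_volterra hl
      (H.continuous_weight_mul K hh) (H.norm_weight_mul_le hK hM) x).continuousAt
  have h2 := H.continuous_cumulative
  unfold weightedVolterra
  fun_prop

/-- Lipschitz dependence of `m V_l h` on all its arguments. -/
lemma norm_mul_weightedVolterra_sub_le (H : Lobe C S dS x₀) (hK : 0 < K) {l l' : ℂ}
    (hl : 0 ≤ l.im) (hl' : 0 ≤ l'.im) {h h' : ℝ → ℂ} (hh : Continuous h) (hh' : Continuous h')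
    {M M' : ℝ} (hM : ∀ x, ‖h x - h' x‖ ≤ M) (hM' : ∀ x, ‖h' x‖ ≤ M') {δ : ℝ}
    (hδ : ∀ t : ℝ, 0 ≤ t → ‖Complex.exp (2 * Complex.I * l * (t : ℝ))
      - Complex.exp (2 * Complex.I * l' * (t : ℝ))‖ ≤ δ) (m m' : ℂ) (x : ℝ) :
    ‖Complex.I * m * weightedVolterra C S K l h x
        - Complex.I * m' * weightedVolterra C S K l' h' x‖
      ≤ ‖m‖ / K * M + (‖m - m'‖ + ‖m'‖ * δ) * (M' / K) := by
  have hMh : ∀ x, ‖h x‖ ≤ M + M' := fun x => by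
    calc ‖h x‖ = ‖(h x - h' x) + h' x‖ := by ring_nf
      _ ≤ _ := (norm_add_le _ _).trans (add_le_add (hM x) (hM' x))
  have e : Complex.I * m * weightedVolterra C S K l h x
        - Complex.I * m' * weightedVolterra C S K l' h' x
      = Complex.I * m * weightedVolterra C S K l (fun x => h x - h' x) x
        + Complex.I * (m - m') * weightedVolterra C S K l h' x
        + Complex.I * m' * (weightedVolterra C S K l h' x - weightedVolterra C S K l' h' x) := by
    rw [H.weightedVolterra_sub hK hl hh hMh hh' hM']
    ring
  rw [e]
  refine (norm_add₃_le).trans ?_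
  simp only [norm_mul, Complex.norm_I, one_mul]
  have h1 : ‖weightedVolterra C S K l (fun x => h x - h' x) x‖ ≤ M / K :=
    H.norm_weightedVolterra_le hK hl (hh.sub hh') hM x
  have h2 := H.norm_weightedVolterra_le hK hl hh' hM' x
  have h3 := H.norm_weightedVolterra_sub_le hK hl hl' hh' hM' hδ x
  calc _ ≤ ‖m‖ * (M / K) + ‖m - m'‖ * (M' / K) + ‖m'‖ * (δ * (M' / K)) := by gcongr
    _ = _ := by ring

end Lobe
end SineGordon
-- Jost solutions by contraction
namespace SineGordon

open scoped BoundedContinuousFunction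

namespace Lobe

variable {C S dS : ℝ → ℝ} {x₀ : ℝ} {K : ℝ}

/-- The weighted Volterra system for the normalized Jost solution at `-∞`. -/
noncomputable def jostMap (C S : ℝ → ℝ) (K : ℝ) (l m : ℂ) (n : ℝ →ᵇ ℂ × ℂ) (x : ℝ) : ℂ × ℂ :=
  ((Real.exp (-(K * cumulative S x)) : ℂ)
      + Complex.I * m * weightedVolterra C S K 0 (fun y => (n y).2) x,
    Complex.I * m * weightedVolterra C S K l (fun y => (n y).1) x)

/-- One estimate with two uses: equal parameters give the contraction, different ones the continuity
of the fixed point in `(l, m)`. -/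
lemma norm_jostMap_sub_le (H : Lobe C S dS x₀) (hK : 0 < K) {l l' : ℂ}
    (hl : 0 ≤ l.im) (hl' : 0 ≤ l'.im) {δ : ℝ}
    (hδ : ∀ t : ℝ, 0 ≤ t → ‖Complex.exp (2 * Complex.I * l * (t : ℝ))
      - Complex.exp (2 * Complex.I * l' * (t : ℝ))‖ ≤ δ) (m m' : ℂ) (n n' : ℝ →ᵇ ℂ × ℂ) (x : ℝ) :
    ‖jostMap C S K l m n x - jostMap C S K l' m' n' x‖
      ≤ ‖m‖ / K * ‖n - n'‖ + (‖m - m'‖ + ‖m'‖ * δ) * (‖n'‖ / K) := by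
  have hδ0 : 0 ≤ δ := (norm_nonneg _).trans (hδ 0 le_rfl)
  have h1 : ∀ y, ‖(n y).1 - (n' y).1‖ ≤ ‖n - n'‖ := fun y =>
    (norm_fst_le (n y - n' y)).trans ((n - n').norm_coe_le_norm y)
  have h2 : ∀ y, ‖(n y).2 - (n' y).2‖ ≤ ‖n - n'‖ := fun y =>
    (norm_snd_le (n y - n' y)).trans ((n - n').norm_coe_le_norm y)
  have h3 : ∀ y, ‖(n' y).1‖ ≤ ‖n'‖ := fun y => (norm_fst_le (n' y)).trans (n'.norm_coe_le_norm y)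
  have h4 : ∀ y, ‖(n' y).2‖ ≤ ‖n'‖ := fun y => (norm_snd_le (n' y)).trans (n'.norm_coe_le_norm y)
  refine norm_prod_le_iff.2 ⟨?_, ?_⟩
  · simp only [jostMap, Prod.fst_sub, add_sub_add_left_eq_sub]
    exact H.norm_mul_weightedVolterra_sub_le hK le_rfl le_rfl n.continuous.snd n'.continuous.snd
      h2 h4 (fun t _ => by simpa using hδ0) m m' x
  · exact H.norm_mul_weightedVolterra_sub_le hK hl hl' n.continuous.fst n'.continuous.fst h1 h3
      hδ m m' x

lemma exists_fixedPoint (H : Lobe C S dS x₀) (hK : 0 < K) {l m : ℂ} (hl : 0 ≤ l.im)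
    (hm : ‖m‖ ≤ K / 2) : ∃ n : ℝ →ᵇ ℂ × ℂ, ∀ x, n x = jostMap C S K l m n x := by
  have hc : ∀ n : ℝ →ᵇ ℂ × ℂ, Continuous (jostMap C S K l m n) := fun n => by
    have h1 := H.continuous_weightedVolterra hK le_rfl n.continuous.snd (l := 0)
      fun y => (norm_snd_le (n y)).trans (n.norm_coe_le_norm y)
    have h2 := H.continuous_weightedVolterra hK hl n.continuous.fst
      fun y => (norm_fst_le (n y)).trans (n.norm_coe_le_norm y)
    have h3 := H.continuous_cumulative
    unfold jostMap
    fun_prop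
  have hsub : ∀ (n n' : ℝ →ᵇ ℂ × ℂ) x,
      ‖jostMap C S K l m n x - jostMap C S K l m n' x‖ ≤ 1 / 2 * ‖n - n'‖ := fun n n' x => by
    refine (H.norm_jostMap_sub_le hK hl hl (δ := 0) (by simp) m m n n' x).trans ?_
    simp only [sub_self, norm_zero, mul_zero, add_zero, zero_mul]
    have : ‖m‖ / K ≤ 1 / 2 := by rw [div_le_div_iff₀ hK two_pos]; linarith
    gcongr
  have h0 : ∀ x, ‖jostMap C S K l m 0 x‖ ≤ 1 := fun x => by
    have : jostMap C S K l m 0 x = ((Real.exp (-(K * cumulative S x)) : ℂ), 0) := by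
      simp [jostMap, weightedVolterra, volterra]
    rw [this]
    refine norm_prod_le_iff.2 ⟨?_, by simp⟩
    rw [Complex.norm_real, Real.norm_of_nonneg (Real.exp_pos _).le, Real.exp_le_one_iff]
    have := mul_nonneg hK.le (H.cumulative_nonneg x)
    linarith
  let T : (ℝ →ᵇ ℂ × ℂ) → (ℝ →ᵇ ℂ × ℂ) := fun n =>
    BoundedContinuousFunction.ofNormedAddCommGroup (jostMap C S K l m n) (hc n)
      (1 / 2 * ‖n - 0‖ + 1) fun x => by
        calc _ = ‖(jostMap C S K l m n x - jostMap C S K l m 0 x) + jostMap C S K l m 0 x‖ := by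
              rw [sub_add_cancel]
          _ ≤ _ := (norm_add_le _ _).trans (add_le_add (hsub n 0 x) (h0 x))
  have hT : ContractingWith (1 / 2) T := by
    refine ⟨by norm_num, LipschitzWith.of_dist_le_mul fun n n' => ?_⟩
    rw [dist_eq_norm, dist_eq_norm]
    refine (BoundedContinuousFunction.norm_le (by positivity)).2 fun x => ?_
    exact (hsub n n' x).trans (by simp)
  refine ⟨hT.fixedPoint T, fun x => ?_⟩
  have := hT.fixedPoint_isFixedPt
  exact (congrArg (fun n : ℝ →ᵇ ℂ × ℂ => n x) this).symm

/-- The solution of the scattering problem attached to a fixed point of `jostMap`. -/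
noncomputable def jostFst (C S : ℝ → ℝ) (K : ℝ) (l : ℂ) (n : ℝ →ᵇ ℂ × ℂ) (x : ℝ) : ℂ :=
  Complex.exp (-(Complex.I * l * phase C x)) * ((Real.exp (K * cumulative S x) : ℂ) * (n x).1)

/-- The second component of the solution attached to a fixed point of `jostMap`. -/
noncomputable def jostSnd (C S : ℝ → ℝ) (K : ℝ) (l : ℂ) (n : ℝ →ᵇ ℂ × ℂ) (x : ℝ) : ℂ :=
  Complex.exp (-(Complex.I * l * phase C x)) * ((Real.exp (K * cumulative S x) : ℂ) * (n x).2)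

section fixed

variable {l m : ℂ} {n : ℝ →ᵇ ℂ × ℂ}

/-- Removing the weight recovers the unweighted Volterra equation, where the inhomogeneity is the
constant `1`. -/
lemma exp_mul_fst (hn : ∀ x, n x = jostMap C S K l m n x) (x : ℝ) :
    (Real.exp (K * cumulative S x) : ℂ) * (n x).1
      = 1 + Complex.I * m
        * volterra C S 0 (fun y => (Real.exp (K * cumulative S y) : ℂ) * (n y).2) x := by
  have h1 : (n x).1 = _ := congrArg Prod.fst (hn x)
  rw [h1]
  have he : (Real.exp (K * cumulative S x) : ℂ) * (Real.exp (-(K * cumulative S x)) : ℂ) = 1 := by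
    rw [← Complex.ofReal_mul, ← Real.exp_add]; simp
  simp only [jostMap, weightedVolterra]
  linear_combination (1 + Complex.I * m
        * volterra C S 0 (fun y => (Real.exp (K * cumulative S y) : ℂ) * (n y).2) x) * he

lemma exp_mul_snd (hn : ∀ x, n x = jostMap C S K l m n x) (x : ℝ) :
    (Real.exp (K * cumulative S x) : ℂ) * (n x).2
      = Complex.I * m
        * volterra C S l (fun y => (Real.exp (K * cumulative S y) : ℂ) * (n y).1) x := by
  have h1 : (n x).2 = _ := congrArg Prod.snd (hn x)
  rw [h1]
  have he : (Real.exp (K * cumulative S x) : ℂ) * (Real.exp (-(K * cumulative S x)) : ℂ) = 1 := by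
    rw [← Complex.ofReal_mul, ← Real.exp_add]; simp
  simp only [jostMap, weightedVolterra]
  linear_combination (Complex.I * m
        * volterra C S l (fun y => (Real.exp (K * cumulative S y) : ℂ) * (n y).1) x) * he

lemma sol_jost (H : Lobe C S dS x₀) (hK : 0 < K) (hl : 0 ≤ l.im)
    (hn : ∀ x, n x = jostMap C S K l m n x) :
    Sol C S l m (jostFst C S K l n) (jostSnd C S K l n) := by
  have hn1 := H.norm_weight_mul_le hK
    (fun y => (norm_fst_le (n y)).trans (n.norm_coe_le_norm y))
  have hn2 := H.norm_weight_mul_le hK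
    (fun y => (norm_snd_le (n y)).trans (n.norm_coe_le_norm y))
  have hc1 := H.continuous_weight_mul K n.continuous.fst
  have hc2 := H.continuous_weight_mul K n.continuous.snd
  have hE : ∀ x, HasDerivAt (fun x => Complex.exp (-(Complex.I * l * phase C x)))
      (Complex.exp (-(Complex.I * l * phase C x)) * -(Complex.I * l * C x)) x := fun x =>
    ((H.hasDerivAt_phase x).ofReal_comp.const_mul (Complex.I * l)).neg.cexp
  have e1 : jostFst C S K l n = fun x => Complex.exp (-(Complex.I * l * phase C x))
      * (1 + Complex.I * m
        * volterra C S 0 (fun y => (Real.exp (K * cumulative S y) : ℂ) * (n y).2) x) :=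
    funext fun x => by rw [jostFst, exp_mul_fst hn]
  have e2 : jostSnd C S K l n = fun x => Complex.exp (-(Complex.I * l * phase C x))
      * (Complex.I * m
        * volterra C S l (fun y => (Real.exp (K * cumulative S y) : ℂ) * (n y).1) x) :=
    funext fun x => by rw [jostSnd, exp_mul_snd hn]
  refine ⟨fun x => ?_, fun x => ?_⟩
  · have hd := (hE x).mul (((H.hasDerivAt_volterra (l := 0) le_rfl hc2 hn2 x).const_mul
      (Complex.I * m)).const_add 1)
    rw [show jostSnd C S K l n x = _ from rfl, jostSnd, e1]
    refine hd.congr_deriv ?_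
    ring
  · have hd := (hE x).mul ((H.hasDerivAt_volterra hl hc1 hn1 x).const_mul
      (Complex.I * m))
    rw [show jostFst C S K l n x = _ from rfl, jostFst, e2]
    refine hd.congr_deriv ?_
    ring

lemma integral_weight_le_cumulative (H : Lobe C S dS x₀) {h : ℝ → ℂ}
    {M : ℝ} (hM : ∀ x, ‖h x‖ ≤ M) (x : ℝ) :
    ∫ y in Set.Iic x, S y * ‖h y‖ ≤ M * cumulative S x := by
  rw [cumulative, ← integral_const_mul]
  refine integral_mono_of_nonneg (Eventually.of_forall fun y =>
    mul_nonneg (H.S_pos y).le (norm_nonneg _)) (H.integrable.const_mul M).integrableOn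
    (Eventually.of_forall fun y => ?_)
  simp only
  rw [mul_comm]
  exact mul_le_mul_of_nonneg_right (hM y) (H.S_pos y).le

lemma tendsto_volterra (H : Lobe C S dS x₀) (hl : 0 ≤ l.im) {h : ℝ → ℂ} (hh : Continuous h)
    {M : ℝ} (hM : ∀ x, ‖h x‖ ≤ M) : Tendsto (volterra C S l h) atBot (𝓝 0) := by
  refine squeeze_zero_norm (fun x => (H.norm_volterra_le hl hh hM x).trans
    (H.integral_weight_le_cumulative hM x)) ?_
  simpa using H.tendsto_cumulative.const_mul M

lemma tendsto_jost (H : Lobe C S dS x₀) (hK : 0 < K) (hl : 0 ≤ l.im)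
    (hn : ∀ x, n x = jostMap C S K l m n x) :
    Tendsto (fun x => Complex.exp (Complex.I * l * phase C x) * jostFst C S K l n x) atBot (𝓝 1) ∧
    Tendsto (fun x => Complex.exp (Complex.I * l * phase C x) * jostSnd C S K l n x)
      atBot (𝓝 0) := by
  have hn1 := H.norm_weight_mul_le hK
    (fun y => (norm_fst_le (n y)).trans (n.norm_coe_le_norm y))
  have hn2 := H.norm_weight_mul_le hK
    (fun y => (norm_snd_le (n y)).trans (n.norm_coe_le_norm y))
  have hc1 := H.continuous_weight_mul K n.continuous.fst
  have hc2 := H.continuous_weight_mul K n.continuous.snd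
  have he : ∀ x, Complex.exp (Complex.I * l * phase C x)
      * Complex.exp (-(Complex.I * l * phase C x)) = 1 := fun x => by
    rw [← Complex.exp_add]; simp
  constructor
  · have h1 := ((H.tendsto_volterra (l := 0) le_rfl hc2 hn2).const_mul (Complex.I * m)).const_add 1
    rw [mul_zero, add_zero] at h1
    refine h1.congr fun x => ?_
    rw [jostFst, exp_mul_fst hn, ← mul_assoc, he, one_mul]
  · have h1 := (H.tendsto_volterra hl hc1 hn1).const_mul (Complex.I * m)
    rw [mul_zero] at h1
    refine h1.congr fun x => ?_
    rw [jostSnd, exp_mul_snd hn, ← mul_assoc, he, one_mul]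

lemma norm_exp_mul_weight_le (H : Lobe C S dS x₀) (hK : 0 < K) {c : ℂ} {M : ℝ}
    (hc : ‖c‖ ≤ M) (x : ℝ) :
    ‖Complex.exp (-(Complex.I * l * phase C x)) * ((Real.exp (K * cumulative S x) : ℂ) * c)‖
      ≤ Real.exp (K * ∫ y, S y) * M * Real.exp (l.im * phase C x) := by
  rw [norm_mul, mul_comm, Complex.norm_exp]
  have h1 := H.norm_weight_mul_le hK (h := fun _ => c) (fun _ => hc) x
  have h2 : (-(Complex.I * l * phase C x)).re = l.im * phase C x := by simp
  rw [h2]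
  gcongr

end fixed

/-- Jost solutions at `-∞`, for parameters near a given one, with a uniform bound and continuous
dependence on the parameters. -/
theorem exists_jost (H : Lobe C S dS x₀) {l₀ m₀ : ℂ} (h₀ : 0 < l₀.im) :
    ∃ (F G : ℂ × ℂ → ℝ → ℂ) (M : ℝ),
      (∀ᶠ q in 𝓝 (l₀, m₀), Sol C S q.1 q.2 (F q) (G q) ∧
        Tendsto (fun x => Complex.exp (Complex.I * q.1 * phase C x) * F q x) atBot (𝓝 1) ∧
        Tendsto (fun x => Complex.exp (Complex.I * q.1 * phase C x) * G q x) atBot (𝓝 0) ∧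
        ∀ x, ‖F q x‖ ≤ M * Real.exp (q.1.im * phase C x) ∧
          ‖G q x‖ ≤ M * Real.exp (q.1.im * phase C x)) ∧
      ∀ x, ContinuousAt (fun q => F q x) (l₀, m₀) ∧ ContinuousAt (fun q => G q x) (l₀, m₀) := by
  -- One weight for all `m` near `m₀`: the bound `‖m‖ ≤ K / 2` is strict at `m₀`, so it persists
  -- nearby and keeps the contraction factor at most `1/2`.
  set K := 2 * (‖m₀‖ + 1) with hKdef
  have hK : 0 < K := by positivity
  have hex : ∀ q : ℂ × ℂ, ∃ n : ℝ →ᵇ ℂ × ℂ, 0 ≤ q.1.im → ‖q.2‖ ≤ K / 2 →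
      ∀ x, n x = jostMap C S K q.1 q.2 n x := fun q => by
    by_cases h : 0 ≤ q.1.im ∧ ‖q.2‖ ≤ K / 2
    · obtain ⟨n, hn⟩ := H.exists_fixedPoint hK h.1 h.2
      exact ⟨n, fun _ _ => hn⟩
    · exact ⟨0, fun h1 h2 => absurd ⟨h1, h2⟩ h⟩
  choose N hN using hex
  have hl0 : ∀ᶠ q : ℂ × ℂ in 𝓝 (l₀, m₀), 0 ≤ q.1.im := by
    have : ContinuousAt (fun q : ℂ × ℂ => q.1.im) (l₀, m₀) := by fun_prop
    exact (this.eventually (lt_mem_nhds h₀)).mono fun q hq => hq.le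
  have hm0 : ∀ᶠ q : ℂ × ℂ in 𝓝 (l₀, m₀), ‖q.2‖ ≤ K / 2 := by
    have : ContinuousAt (fun q : ℂ × ℂ => ‖q.2‖) (l₀, m₀) := by fun_prop
    refine (this.eventually (ge_mem_nhds ?_))
    simp [hKdef]
  have hd0 : ∀ᶠ q : ℂ × ℂ in 𝓝 (l₀, m₀), ‖q.1 - l₀‖ ≤ l₀.im / 2 := by
    have : ContinuousAt (fun q : ℂ × ℂ => ‖q.1 - l₀‖) (l₀, m₀) := by fun_prop
    refine (this.eventually (ge_mem_nhds ?_))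
    simpa using h₀
  have hn0 := hN (l₀, m₀) h₀.le hm0.self_of_nhds
  set n₀ := N (l₀, m₀)
  have hlip : ∀ᶠ q in 𝓝 (l₀, m₀), ‖N q - n₀‖
      ≤ 2 * ((‖q.2 - m₀‖ + ‖m₀‖ * (2 / l₀.im * ‖q.1 - l₀‖)) * (‖n₀‖ / K)) := by
    filter_upwards [hl0, hm0, hd0] with q h1 h2 h3
    have hq := hN q h1 h2
    -- Subtracting the two fixed-point equations; the half on the right is absorbed on the left.
    have : ‖N q - n₀‖ ≤ 1 / 2 * ‖N q - n₀‖
        + (‖q.2 - m₀‖ + ‖m₀‖ * (2 / l₀.im * ‖q.1 - l₀‖)) * (‖n₀‖ / K) := by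
      refine (BoundedContinuousFunction.norm_le (by positivity)).2 fun x => ?_
      rw [BoundedContinuousFunction.coe_sub, Pi.sub_apply, hq x, hn0 x]
      refine (H.norm_jostMap_sub_le hK h1 h₀.le (fun t ht => norm_exp_sub_exp_le h₀ h3 ht)
        q.2 m₀ (N q) n₀ x).trans ?_
      have : ‖q.2‖ / K ≤ 1 / 2 := by rw [div_le_div_iff₀ hK two_pos]; linarith
      gcongr
    linarith
  have hcont : ContinuousAt N (l₀, m₀) := by
    rw [ContinuousAt, tendsto_iff_norm_sub_tendsto_zero]
    refine squeeze_zero' (Eventually.of_forall fun _ => norm_nonneg _) hlip ?_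
    have : ContinuousAt (fun q : ℂ × ℂ =>
      2 * ((‖q.2 - m₀‖ + ‖m₀‖ * (2 / l₀.im * ‖q.1 - l₀‖)) * (‖n₀‖ / K))) (l₀, m₀) := by fun_prop
    simpa [ContinuousAt] using this
  have hpt : ∀ x, ContinuousAt (fun q => N q x) (l₀, m₀) := fun x =>
    (BoundedContinuousFunction.evalCLM ℂ x).continuous.continuousAt.comp hcont
  refine ⟨fun q => jostFst C S K q.1 (N q), fun q => jostSnd C S K q.1 (N q),
    Real.exp (K * ∫ y, S y) * (‖n₀‖ + 1), ?_, fun x => ⟨?_, ?_⟩⟩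
  · have hb : ∀ᶠ q in 𝓝 (l₀, m₀), ‖N q‖ ≤ ‖n₀‖ + 1 :=
      hcont.norm.eventually (ge_mem_nhds (by linarith))
    filter_upwards [hl0, hm0, hb] with q h1 h2 h3
    have hq := hN q h1 h2
    have ht := H.tendsto_jost hK h1 hq
    exact ⟨H.sol_jost hK h1 hq, ht.1, ht.2, fun x =>
      ⟨H.norm_exp_mul_weight_le hK
        ((norm_fst_le (N q x)).trans (((N q).norm_coe_le_norm x).trans h3)) x,
      H.norm_exp_mul_weight_le hK
        ((norm_snd_le (N q x)).trans (((N q).norm_coe_le_norm x).trans h3)) x⟩⟩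
  · have := (hpt x).fst
    simp only [jostFst]
    fun_prop
  · have := (hpt x).snd
    simp only [jostSnd]
    fun_prop

end Lobe
end SineGordon
-- The derivative of the Wronskian in the spectral parameter
namespace SineGordon

lemma Lobe.exp_mul_phase_le {C S dS : ℝ → ℝ} {x₀ : ℝ} (H : Lobe C S dS x₀)
    {η t x : ℝ} (hη : 0 ≤ η) (ht : η ≤ t) (hx : x ≤ 0) : Real.exp (t * phase C x) ≤ Real.exp (η * C x₀ * x) := by
  refine Real.exp_le_exp.2 ?_
  have h1 := H.phase_le hx
  have h2 : phase C x ≤ 0 := h1.trans (mul_nonpos_of_nonneg_of_nonpos (H.C_pos x₀).le hx)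
  nlinarith

namespace Sol

variable {C S dS : ℝ → ℝ} {x₀ : ℝ} {lam mu : ℂ → ℂ} {lam' mu' z : ℂ} {f g : ℝ → ℂ}

/-- The Wronskian of a solution and its image under the derivative of the coefficient matrix in the
direction `(a, b)` of the parameters. -/
noncomputable def variation (C S : ℝ → ℝ) (a b : ℂ) (p q f g : ℝ → ℂ) (x : ℝ) : ℂ :=
  -Complex.I * a * C x * (p x * g x + q x * f x) + Complex.I * b * S x * (q x * g x - p x * f x)

lemma norm_variation_le (H : Lobe C S dS x₀) {a b : ℂ} {p q : ℝ → ℂ} {x M B : ℝ}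
    (hp : ‖p x‖ ≤ M) (hq : ‖q x‖ ≤ M) (hf : ‖f x‖ ≤ B) (hg : ‖g x‖ ≤ B) :
    ‖variation C S a b p q f g x‖ ≤ (‖a‖ + ‖b‖) * (2 * B * M) := by
  have hM : 0 ≤ M := (norm_nonneg _).trans hp
  have hB : 0 ≤ B := (norm_nonneg _).trans hf
  have hC : ‖(C x : ℂ)‖ ≤ 1 := by rw [Complex.norm_real]; exact H.abs_C_le_one x
  have hS : ‖(S x : ℂ)‖ ≤ 1 := by rw [Complex.norm_real]; exact H.abs_S_le_one x
  have h1 : ‖p x * g x + q x * f x‖ ≤ M * B + M * B := by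
    refine (norm_add_le _ _).trans ?_
    rw [norm_mul, norm_mul]
    gcongr
  have h2 : ‖q x * g x - p x * f x‖ ≤ M * B + M * B := by
    refine (norm_sub_le _ _).trans ?_
    rw [norm_mul, norm_mul]
    gcongr
  unfold variation
  refine (norm_add_le _ _).trans ?_
  simp only [norm_mul, norm_neg, Complex.norm_I, one_mul]
  calc _ ≤ ‖a‖ * 1 * (M * B + M * B) + ‖b‖ * 1 * (M * B + M * B) := by gcongr
    _ = _ := by ring

lemma continuous_variation (H : Lobe C S dS x₀) {a b : ℂ} {p q : ℝ → ℂ} (hp : Continuous p)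
    (hq : Continuous q) (hf : Continuous f) (hg : Continuous g) :
    Continuous (variation C S a b p q f g) := by
  have := H.continuous_C
  have := H.continuous_S
  unfold variation
  fun_prop

/-- The derivative at `z` of the Wronskian of a family of solutions decaying at `-∞` and a fixed
solution, to which the family is proportional at `z`. -/
lemma hasDerivAt_wronskian_param (H : Lobe C S dS x₀) (hlam : HasDerivAt lam lam' z)
    (hmu : HasDerivAt mu mu' z) (hz : 0 < (lam z).im) {F G : ℂ → ℝ → ℂ} {M B : ℝ}
    (hFG : ∀ᶠ w in 𝓝 z, Sol C S (lam w) (mu w) (F w) (G w) ∧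
      ∀ x, ‖F w x‖ ≤ M * Real.exp ((lam w).im * phase C x) ∧
          ‖G w x‖ ≤ M * Real.exp ((lam w).im * phase C x))
    (hcont : ∀ x, ContinuousAt (fun w => F w x) z ∧ ContinuousAt (fun w => G w x) z)
    (hφ : Sol C S (lam z) (mu z) f g) (hB : ∀ x ≤ 0, ‖f x‖ ≤ B ∧ ‖g x‖ ≤ B)
    (h0 : F z 0 * g 0 - G z 0 * f 0 = 0) :
    HasDerivAt (fun w => F w 0 * g 0 - G w 0 * f 0)
      (∫ x in Set.Iic 0, variation C S lam' mu' (F z) (G z) f g x) z := by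
  -- Half of the decay rate at `z` is a rate valid for all nearby `w`, so a single integrable `E`
  -- dominates.
  set η := (lam z).im / 2 with hη
  have hη0 : 0 < η := by positivity
  have hM : 0 ≤ M := nonneg_of_mul_nonneg_left
    ((norm_nonneg _).trans (hFG.self_of_nhds.2 0).1) (Real.exp_pos _)
  have hB0 : 0 ≤ B := (norm_nonneg _).trans (hB 0 le_rfl).1
  have him : ∀ᶠ w in 𝓝 z, η ≤ (lam w).im := by
    have : ContinuousAt (fun w => (lam w).im) z :=
      Complex.continuous_im.continuousAt.comp hlam.continuousAt
    exact this.eventually (le_mem_nhds (by linarith))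
  set E : ℝ → ℝ := fun x => 2 * B * (M * Real.exp (η * C x₀ * x)) with hE
  have hc : 0 < η * C x₀ := mul_pos hη0 (H.C_pos x₀)
  have hEi : IntegrableOn E (Set.Iic 0) :=
    ((integrableOn_exp_mul_Iic hc 0).const_mul M).const_mul (2 * B)
  have hall := hFG.and him
  have hbd : ∀ᶠ w in 𝓝 z, ∀ a b : ℂ, ∀ x ≤ 0,
      ‖variation C S a b (F w) (G w) f g x‖ ≤ (‖a‖ + ‖b‖) * E x := by
    filter_upwards [hall] with w hw a b x hx
    have he := H.exp_mul_phase_le hη0.le hw.2 hx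
    have h1 := hw.1.2 x
    exact norm_variation_le H (h1.1.trans (by gcongr)) (h1.2.trans (by gcongr)) (hB x hx).1
      (hB x hx).2
  have hmeas : ∀ᶠ w in 𝓝 z, ∀ a b : ℂ, AEStronglyMeasurable
      (variation C S a b (F w) (G w) f g) (volume.restrict (Set.Iic 0)) := by
    filter_upwards [hall] with w hw a b
    exact (continuous_variation H hw.1.1.continuous_left hw.1.1.continuous_right
      hφ.continuous_left hφ.continuous_right).aestronglyMeasurable
  -- The Wronskian vanishes at `-∞`, because the family decays there and `(f, g)` is bounded on the
  -- left half-line; hence it is the integral of its `x`-derivative.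
  have hint : ∀ᶠ w in 𝓝 z, F w 0 * g 0 - G w 0 * f 0
      = ∫ x in Set.Iic 0, variation C S (lam w - lam z) (mu w - mu z) (F w) (G w) f g x := by
    filter_upwards [hall, hbd, hmeas] with w hw hb hm
    have hi : IntegrableOn (variation C S (lam w - lam z) (mu w - mu z) (F w) (G w) f g)
        (Set.Iic 0) :=
      (hEi.const_mul (‖lam w - lam z‖ + ‖mu w - mu z‖)).mono' (hm _ _)
        ((ae_restrict_iff' measurableSet_Iic).2 (Eventually.of_forall fun x hx => hb _ _ x hx))
    have hEl : Tendsto E atBot (𝓝 0) := by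
      have := ((Real.tendsto_exp_atBot.comp (tendsto_id.const_mul_atBot hc)).const_mul M).const_mul
        (2 * B)
      simpa [hE] using this
    have hl : Tendsto (fun x => F w x * g x - G w x * f x) atBot (𝓝 0) := by
      refine squeeze_zero_norm' ?_ hEl
      filter_upwards [eventually_le_atBot 0] with x hx
      have he := H.exp_mul_phase_le hη0.le hw.2 hx
      have h1 := hw.1.2 x
      have h2 := hB x hx
      have h3 : ‖F w x‖ ≤ M * Real.exp (η * C x₀ * x) := h1.1.trans (by gcongr)
      have h4 : ‖G w x‖ ≤ M * Real.exp (η * C x₀ * x) := h1.2.trans (by gcongr)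
      refine (norm_sub_le _ _).trans ?_
      rw [norm_mul, norm_mul]
      calc _ ≤ M * Real.exp (η * C x₀ * x) * B + M * Real.exp (η * C x₀ * x) * B := by
            have := h2.1
            have := h2.2
            gcongr
        _ = E x := by simp only [hE]; ring
    have := integral_Iic_of_hasDerivAt_of_tendsto' (a := 0)
      (fun x _ => hw.1.1.hasDerivAt_wronskian hφ x) hi hl
    rw [sub_zero] at this
    exact this.symm
  rw [hasDerivAt_iff_tendsto_slope]
  -- The integrand is linear in the parameter increments, so dividing by `w - z` turns them into
  -- slopes. No derivative of `F` or `G` in `w` is needed.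
  have hsl : ∀ᶠ w in 𝓝[≠] z, slope (fun w => F w 0 * g 0 - G w 0 * f 0) z w
      = ∫ x in Set.Iic 0, variation C S (slope lam z w) (slope mu z w) (F w) (G w) f g x := by
    filter_upwards [nhdsWithin_le_nhds hint] with w hw
    rw [slope_def_field, h0, sub_zero, hw, div_eq_inv_mul, ← integral_const_mul]
    congr 1
    funext x
    simp only [variation, slope_def_field]
    ring
  refine Tendsto.congr' (hsl.mono fun w hw => hw.symm) ?_
  have hsl1 := hasDerivAt_iff_tendsto_slope.1 hlam
  have hsl2 := hasDerivAt_iff_tendsto_slope.1 hmu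
  refine tendsto_integral_filter_of_dominated_convergence
    (fun x => (‖lam'‖ + 1 + (‖mu'‖ + 1)) * E x) ?_ ?_ (hEi.const_mul _) ?_
  · filter_upwards [nhdsWithin_le_nhds hmeas] with w hw using hw _ _
  · filter_upwards [nhdsWithin_le_nhds hbd,
      hsl1.norm.eventually (ge_mem_nhds (show ‖lam'‖ < ‖lam'‖ + 1 by linarith)),
      hsl2.norm.eventually (ge_mem_nhds (show ‖mu'‖ < ‖mu'‖ + 1 by linarith))] with w hw h1 h2
    refine (ae_restrict_iff' measurableSet_Iic).2 (Eventually.of_forall fun x hx => ?_)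
    refine (hw _ _ x hx).trans ?_
    have : 0 ≤ E x := by positivity
    gcongr
  · refine Eventually.of_forall fun x => ?_
    have hF : Tendsto (fun w => F w x) (𝓝[≠] z) (𝓝 (F z x)) := (hcont x).1.tendsto.mono_left
      nhdsWithin_le_nhds
    have hG : Tendsto (fun w => G w x) (𝓝[≠] z) (𝓝 (G z x)) := (hcont x).2.tendsto.mono_left
      nhdsWithin_le_nhds
    exact (((hsl1.const_mul (-Complex.I)).mul_const _).mul
        ((hF.mul_const _).add (hG.mul_const _))).add
      (((hsl2.const_mul Complex.I).mul_const _).mul ((hG.mul_const _).sub (hF.mul_const _)))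

end Sol

/-- As `q z = 0`, the difference quotient of the product is `p w` times that of `q`; continuity of
`p` suffices. -/
lemma hasDerivAt_mul_of_eq_zero {p q : ℂ → ℂ} {q' z : ℂ} (hp : ContinuousAt p z)
    (hq : HasDerivAt q q' z) (h0 : q z = 0) : HasDerivAt (fun w => p w * q w) (p z * q') z := by
  rw [hasDerivAt_iff_tendsto_slope] at hq ⊢
  refine ((hp.tendsto.mono_left nhdsWithin_le_nhds).mul hq).congr fun w => ?_
  simp only [slope_def_field, h0]
  ring

lemma phase_comp_neg (C : ℝ → ℝ) (x : ℝ) : phase (fun x => C (-x)) x = -phase C (-x) := by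
  rw [phase, intervalIntegral.integral_comp_neg, neg_zero, phase, intervalIntegral.integral_symm]

namespace Sol

variable {C S dS : ℝ → ℝ} {x₀ : ℝ} {lam mu : ℂ → ℂ} {lam' mu' z : ℂ} {f g : ℝ → ℂ}

/-- The Jost solutions at `-∞` near a parameter with a decaying solution `(f, g)`, and the
derivative of their Wronskian with `(f, g)`. -/
lemma exists_jost_left (H : Lobe C S dS x₀) (hlam : HasDerivAt lam lam' z)
    (hmu : HasDerivAt mu mu' z) (hz : 0 < (lam z).im) (hφ : Sol C S (lam z) (mu z) f g)
    (hbot : Tendsto (density f g) atBot (𝓝 0)) (hne : ∀ x, density f g x ≠ 0) :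
    ∃ (F G : ℂ → ℝ → ℂ) (a : ℂ), a ≠ 0 ∧
      (∀ᶠ w in 𝓝 z, Sol C S (lam w) (mu w) (F w) (G w) ∧
        Tendsto (fun x => Complex.exp (Complex.I * lam w * phase C x) * F w x) atBot (𝓝 1) ∧
        Tendsto (fun x => Complex.exp (Complex.I * lam w * phase C x) * G w x) atBot (𝓝 0)) ∧
      (∀ x, ContinuousAt (fun w => F w x) z ∧ ContinuousAt (fun w => G w x) z) ∧
      (∀ x, F z x = a * f x ∧ G z x = a * g x) ∧
      HasDerivAt (fun w => F w 0 * g 0 - G w 0 * f 0)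
        (a * ∫ x in Set.Iic 0, variation C S lam' mu' f g f g x) z := by
  obtain ⟨F, G, M, hev, hc⟩ := H.exists_jost (m₀ := mu z) hz
  have hq : ContinuousAt (fun w => (lam w, mu w)) z := hlam.continuousAt.prodMk hmu.continuousAt
  have hev' := hq.eventually hev
  have hzz := hev'.self_of_nhds
  obtain ⟨hsol, hl1, hl2, hb⟩ := hzz
  have hexp : Tendsto (fun x => M * Real.exp ((lam z).im * phase C x)) atBot (𝓝 0) := by
    simpa using (Real.tendsto_exp_atBot.comp (H.tendsto_phase.const_mul_atBot hz)).const_mul M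
  obtain ⟨hf0, hg0⟩ := tendsto_components hbot
  have hW := hφ.wronskian_eq_zero hsol hf0 hg0
    (squeeze_zero_norm (fun x => (hb x).1) hexp) (squeeze_zero_norm (fun x => (hb x).2) hexp) 0
  obtain ⟨a, ha⟩ := hφ.exists_proportional hsol H.abs_C_le_one H.abs_S_le_one (hne 0) hW
  -- If `a = 0` the Jost solution would vanish, against its normalization to `1`.
  have ha0 : a ≠ 0 := by
    rintro rfl
    simp only [zero_mul] at ha
    simp only [ha, mul_zero] at hl1
    exact zero_ne_one (tendsto_nhds_unique tendsto_const_nhds hl1)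
  refine ⟨fun w => F (lam w, mu w), fun w => G (lam w, mu w), a, ha0,
    hev'.mono fun w hw => ⟨hw.1, hw.2.1, hw.2.2.1⟩,
    fun x => ⟨(hc x).1.comp (f := fun w => (lam w, mu w)) hq,
      (hc x).2.comp (f := fun w => (lam w, mu w)) hq⟩, ha, ?_⟩
  have hM : 0 ≤ M := nonneg_of_mul_nonneg_left
    ((norm_nonneg _).trans (hb 0).1) (Real.exp_pos _)
  have hbd : ∀ x ≤ 0, ∀ p q : ℂ, ‖q‖ ≤ M * Real.exp ((lam z).im * phase C x) → q = a * p →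
      ‖p‖ ≤ M / ‖a‖ := by
    rintro x hx p q hqM rfl
    rw [norm_mul] at hqM
    rw [le_div_iff₀ (norm_pos_iff.2 ha0), mul_comm]
    refine hqM.trans (mul_le_of_le_one_right hM (Real.exp_le_one_iff.2 ?_))
    have h1 := (H.phase_le hx).trans (mul_nonpos_of_nonneg_of_nonpos (H.C_pos x₀).le hx)
    exact mul_nonpos_of_nonneg_of_nonpos hz.le h1
  have key := hasDerivAt_wronskian_param (F := fun w => F (lam w, mu w))
    (G := fun w => G (lam w, mu w)) H hlam hmu hz (hev'.mono fun w hw => ⟨hw.1, hw.2.2.2⟩)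
    (fun x => ⟨(hc x).1.comp (f := fun w => (lam w, mu w)) hq,
      (hc x).2.comp (f := fun w => (lam w, mu w)) hq⟩) hφ
    (B := M / ‖a‖) (fun x hx => ⟨hbd x hx _ _ (hb x).1 (ha x).1, hbd x hx _ _ (hb x).2 (ha x).2⟩)
    (by rw [(ha 0).1, (ha 0).2]; ring)
  refine key.congr_deriv ?_
  rw [← integral_const_mul]
  congr 1
  funext x
  simp only [variation, (ha x).1, (ha x).2]
  ring

/-- The Jost solutions near a parameter with a decaying solution `(f, g)`, and the derivative of
their Wronskian. -/
theorem exists_jost_pair (H : Lobe C S dS x₀) (hlam : HasDerivAt lam lam' z)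
    (hmu : HasDerivAt mu mu' z) (hz : 0 < (lam z).im) (hφ : Sol C S (lam z) (mu z) f g)
    (hbot : Tendsto (density f g) atBot (𝓝 0)) (htop : Tendsto (density f g) atTop (𝓝 0))
    (hne : ∀ x, density f g x ≠ 0) (hi : Integrable (variation C S lam' mu' f g f g)) :
    ∃ (F G P Q : ℂ → ℝ → ℂ) (c : ℂ), c ≠ 0 ∧
      (∀ᶠ w in 𝓝 z, (Sol C S (lam w) (mu w) (F w) (G w) ∧
        Tendsto (fun x => Complex.exp (Complex.I * lam w * phase C x) * F w x) atBot (𝓝 1) ∧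
        Tendsto (fun x => Complex.exp (Complex.I * lam w * phase C x) * G w x) atBot (𝓝 0)) ∧
        (Sol C S (lam w) (mu w) (P w) (Q w) ∧
        Tendsto (fun x => Complex.exp (-(Complex.I * lam w * phase C x)) * P w x) atTop (𝓝 0) ∧
        Tendsto (fun x => Complex.exp (-(Complex.I * lam w * phase C x)) * Q w x) atTop (𝓝 1))) ∧
      HasDerivAt (fun w => F w 0 * Q w 0 - G w 0 * P w 0)
        (c * ∫ x, variation C S lam' mu' f g f g x) z := by
  obtain ⟨F, G, a, ha0, hev, hc, ha, hd⟩ := exists_jost_left H hlam hmu hz hφ hbot hne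
  have hsym : density (fun x => g (-x)) (fun x => f (-x)) = fun x => density f g (-x) :=
    funext fun x => add_comm _ _
  obtain ⟨Q, P, b, hb0, hev', hc', hb, hd'⟩ := exists_jost_left H.reflect hlam hmu.neg hz
    hφ.reflect (by rw [hsym]; exact htop.comp tendsto_neg_atBot_atTop)
    (fun x => by rw [hsym]; exact hne (-x))
  refine ⟨F, G, fun w x => P w (-x), fun w x => Q w (-x), a * b, mul_ne_zero ha0 hb0, ?_, ?_⟩
  · filter_upwards [hev, hev'] with w h1 h2
    refine ⟨h1, ?_, ?_, ?_⟩
    · simpa using h2.1.reflect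
    · refine (h2.2.2.comp tendsto_neg_atTop_atBot).congr fun x => ?_
      simp [phase_comp_neg]
    · refine (h2.2.1.comp tendsto_neg_atTop_atBot).congr fun x => ?_
      simp [phase_comp_neg]
  · have hvar : ∀ x, variation (fun x => C (-x)) (fun x => S (-x)) lam' (-mu') (fun x => g (-x))
        (fun x => f (-x)) (fun x => g (-x)) (fun x => f (-x)) x
        = variation C S lam' mu' f g f g (-x) := fun x => by
      simp only [variation]; ring
    simp only [hvar, neg_zero] at hd'
    rw [integral_comp_neg_Iic 0 (variation C S lam' mu' f g f g), neg_zero] at hd'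
    -- An auxiliary vector transverse to `(f, g)` at `0`: their Wronskian is the density there.
    set e₁ : ℂ := (starRingEnd ℂ) (g 0)
    set e₂ : ℂ := -(starRingEnd ℂ) (f 0)
    have hE : e₁ * g 0 - e₂ * f 0 = density f g 0 := by
      simp only [e₁, e₂, density, Complex.ofReal_add, Complex.normSq_eq_conj_mul_self]
      ring
    have hE0 : e₁ * g 0 - e₂ * f 0 ≠ 0 := by
      rw [hE]; exact_mod_cast hne 0
    -- The Plücker relation in `ℂ²` for the two Jost solutions, `(e₁, e₂)` and `(f, g)` writes their
    -- Wronskian as a sum of two products over the density. In each product the factor involving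
    -- `(f, g)` vanishes at `z` and has a known derivative, while the other is only continuous.
    have d1 := hasDerivAt_mul_of_eq_zero (p := fun w => F w 0 * e₂ - G w 0 * e₁)
      (((hc 0).1.mul_const _).sub ((hc 0).2.mul_const _)) hd'
      (by simp only [(hb 0).1, (hb 0).2, neg_zero]; ring)
    have d2 := hasDerivAt_mul_of_eq_zero (p := fun w => P w 0 * e₂ - Q w 0 * e₁)
      (((hc' 0).2.mul_const _).sub ((hc' 0).1.mul_const _)) hd
      (by simp only [(ha 0).1, (ha 0).2]; ring)
    have hdd := (((d1.add d2).neg).div_const (e₁ * g 0 - e₂ * f 0))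
    simp only [neg_zero]
    refine (hdd.congr_of_eventuallyEq (Eventually.of_forall fun w => ?_)).congr_deriv ?_
    · simp only [Pi.neg_apply, Pi.add_apply]
      rw [eq_div_iff hE0]
      ring
    · rw [← intervalIntegral.integral_Iic_add_Ioi (b := 0) hi.integrableOn hi.integrableOn,
        (ha 0).1, (ha 0).2, (hb 0).1, (hb 0).2, neg_zero, div_eq_iff hE0]
      ring

end Sol
end SineGordon
-- Real reduction and the result for a lobe
namespace SineGordon

namespace Sol

variable {C S dS : ℝ → ℝ} {x₀ : ℝ} {l m : ℂ} {f g : ℝ → ℂ}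

/-- For imaginary `l` and real `m` the decaying solutions can be taken of the form `(p, i h)` with
`p`, `h` real. -/
lemma exists_real (h : Sol C S l m f g) (hl : l.re = 0) (hm : m.im = 0)
    (hne : density f g 0 ≠ 0) :
    ∃ p q : ℝ → ℝ, (∀ x, HasDerivAt p (l.im * C x * p x - m.re * S x * q x) x) ∧
      (∀ x, HasDerivAt q (m.re * S x * p x - l.im * C x * q x) x) ∧
      (∀ x, p x ^ 2 + q x ^ 2 ≤ density f g x) ∧ p 0 ^ 2 + q 0 ^ 2 ≠ 0 := by
  have key : ∀ c : ℂ, ‖c‖ = 1 → (c * f 0).re ^ 2 + (c * g 0).im ^ 2 ≠ 0 →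
      ∃ p q : ℝ → ℝ, (∀ x, HasDerivAt p (l.im * C x * p x - m.re * S x * q x) x) ∧
      (∀ x, HasDerivAt q (m.re * S x * p x - l.im * C x * q x) x) ∧
      (∀ x, p x ^ 2 + q x ^ 2 ≤ density f g x) ∧ p 0 ^ 2 + q 0 ^ 2 ≠ 0 := by
    intro c hc h0
    have hc' := h.const_mul c
    refine ⟨fun x => (c * f x).re, fun x => (c * g x).im,
      fun x => (hc'.hasDerivAt_left_re x).congr_deriv ?_,
      fun x => (hc'.hasDerivAt_right_im x).congr_deriv ?_, fun x => ?_, h0⟩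
    · rw [hl, hm]; ring
    · rw [hl, hm]; ring
    · have h1 : Complex.normSq (c * f x) = Complex.normSq (f x) := by
        rw [map_mul, Complex.normSq_eq_norm_sq c, hc]; ring
      have h2 : Complex.normSq (c * g x) = Complex.normSq (g x) := by
        rw [map_mul, Complex.normSq_eq_norm_sq c, hc]; ring
      rw [density, ← h1, ← h2, Complex.normSq_apply, Complex.normSq_apply]
      nlinarith [sq_nonneg (c * f x).im, sq_nonneg (c * g x).re]
  -- For these parameters `(Re f, Im g)` decouples from `(Im f, Re g)`. If the first pair vanishes
  -- at `0`, multiplication by `i` brings in the second.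
  by_cases h1 : (1 * f 0).re ^ 2 + (1 * g 0).im ^ 2 = 0
  · refine key Complex.I Complex.norm_I fun h2 => hne ?_
    simp at h1 h2
    rw [density, Complex.normSq_apply, Complex.normSq_apply]
    linarith
  · exact key 1 norm_one h1

lemma integrable_form (H : Lobe C S dS x₀) {A B : ℝ} {p q : ℝ → ℝ} (hp : Continuous p)
    (hq : Continuous q) (hi : Integrable fun x => p x ^ 2 + q x ^ 2) :
    Integrable (form C S p q A B) := by
  refine (hi.const_mul (|B| + |A|)).mono'
    (continuous_form H.continuous_C H.continuous_S hp hq).aestronglyMeasurable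
    (Eventually.of_forall fun x => ?_)
  have h1 : |2 * p x * q x| ≤ p x ^ 2 + q x ^ 2 := by
    rw [abs_le]
    constructor <;> nlinarith [sq_nonneg (p x - q x), sq_nonneg (p x + q x)]
  have h2 : 0 ≤ p x ^ 2 + q x ^ 2 := by positivity
  rw [Real.norm_eq_abs]
  calc |form C S p q A B x| = |B * C x * (2 * p x * q x) + A * S x * (p x ^ 2 + q x ^ 2)| := by
        simp only [form]; ring_nf
    _ ≤ |B| * |C x| * |2 * p x * q x| + |A| * |S x| * (p x ^ 2 + q x ^ 2) := by
        refine (abs_add_le _ _).trans ?_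
        rw [abs_mul (B * C x), abs_mul B, abs_mul (A * S x), abs_mul A, abs_of_nonneg h2]
    _ ≤ |B| * 1 * (p x ^ 2 + q x ^ 2) + |A| * 1 * (p x ^ 2 + q x ^ 2) := by
        have := H.abs_C_le_one x
        have := H.abs_S_le_one x
        gcongr
    _ = _ := by ring

lemma variation_ofReal (k : ℂ) (A B : ℝ) (p q : ℝ → ℝ) (x : ℝ) :
    variation C S (k * B) (k * (A * Complex.I)) (fun x => (p x : ℂ)) (fun x => q x * Complex.I)
      (fun x => (p x : ℂ)) (fun x => q x * Complex.I) x = k * (form C S p q A B x : ℂ) := by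
  simp only [variation, form]
  push_cast
  linear_combination (k * (-2 * B * C x * p x * q x
    + A * S x * (q x ^ 2 * (Complex.I ^ 2 - 1) - p x ^ 2))) * Complex.I_sq

end Sol

lemma hasDerivAt_sub_inv {z : ℂ} (hz : z ≠ 0) (e : ℂ) :
    HasDerivAt (fun w : ℂ => e / 4 * (w - 1 / w)) (e / 4 * (1 + 1 / z ^ 2)) z := by
  simp only [one_div]
  exact (((hasDerivAt_id z).sub (hasDerivAt_inv hz)).const_mul (e / 4)).congr_deriv (by ring)

lemma hasDerivAt_add_inv {z : ℂ} (hz : z ≠ 0) (e : ℂ) :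
    HasDerivAt (fun w : ℂ => e / 4 * (w + 1 / w)) (e / 4 * (1 - 1 / z ^ 2)) z := by
  simp only [one_div]
  exact (((hasDerivAt_id z).add (hasDerivAt_inv hz)).const_mul (e / 4)).congr_deriv (by ring)

/-- The two conditions compare real and imaginary parts to give `conj z = 1/z`. -/
lemma norm_eq_one_of_re_of_im {z : ℂ} (hz : z ≠ 0) (h1 : (z - 1 / z).re = 0)
    (h2 : (z + 1 / z).im = 0) : ‖z‖ = 1 := by
  have e1 : (starRingEnd ℂ) z = 1 / z := by
    apply Complex.ext
    · simp only [Complex.sub_re] at h1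
      simp only [Complex.conj_re]; linarith
    · simp only [Complex.add_im] at h2
      simp only [Complex.conj_im]; linarith
  have e2 : z * (starRingEnd ℂ) z = 1 := by rw [e1]; field_simp
  rw [Complex.mul_conj, Complex.normSq_eq_norm_sq] at e2
  have e3 : ‖z‖ ^ 2 = 1 := by exact_mod_cast e2
  exact (pow_eq_one_iff_of_nonneg (norm_nonneg z) two_ne_zero).1 e3

lemma add_inv_im_eq_zero {z : ℂ} (hz : z ≠ 0) (h : (z - 1 / z).im = 0) : (z + 1 / z).im = 0 := by
  have hn := Complex.normSq_pos.2 hz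
  simp only [one_div, Complex.sub_im, Complex.add_im, Complex.inv_im] at h ⊢
  have h1 : z.im * (1 + 1 / Complex.normSq z) = 0 := by
    rw [← h]; ring
  have h2 : z.im = 0 := (mul_eq_zero.1 h1).resolve_right (by positivity)
  simp [h2]

/-- The main result for a lobe profile, with the signs of `cos (u / 2)` and `sin (u / 2)` absorbed
in the spectral parameters. -/
theorem Lobe.norm_eq_one_and_exists_jost {C S dS : ℝ → ℝ} {x₀ : ℝ} (H : Lobe C S dS x₀) {e t z : ℂ}
    (he : e = 1 ∨ e = -1) (ht : t = 1 ∨ t = -1) (hz : z ≠ 0)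
    (him : 0 < (e / 4 * (z - 1 / z)).im) {f g : ℝ → ℂ}
    (hφ : Sol C S (e / 4 * (z - 1 / z)) (t / 4 * (z + 1 / z)) f g)
    (hi : Integrable (density f g)) (hne : ∀ x, density f g x ≠ 0) :
    ‖z‖ = 1 ∧ ∃ (F G P Q : ℂ → ℝ → ℂ) (W' : ℂ), W' ≠ 0 ∧
      (∀ᶠ w in 𝓝 z, (Sol C S (e / 4 * (w - 1 / w)) (t / 4 * (w + 1 / w)) (F w) (G w) ∧
        Tendsto (fun x => Complex.exp (Complex.I * (e / 4 * (w - 1 / w)) * phase C x) * F w x)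
          atBot (𝓝 1) ∧
        Tendsto (fun x => Complex.exp (Complex.I * (e / 4 * (w - 1 / w)) * phase C x) * G w x)
          atBot (𝓝 0)) ∧
        (Sol C S (e / 4 * (w - 1 / w)) (t / 4 * (w + 1 / w)) (P w) (Q w) ∧
        Tendsto (fun x => Complex.exp (-(Complex.I * (e / 4 * (w - 1 / w)) * phase C x)) * P w x)
          atTop (𝓝 0) ∧
        Tendsto (fun x => Complex.exp (-(Complex.I * (e / 4 * (w - 1 / w)) * phase C x)) * Q w x)
          atTop (𝓝 1))) ∧
      HasDerivAt (fun w => F w 0 * Q w 0 - G w 0 * P w 0) W' z := by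
  have hlim := hφ.tendsto_density_zero H.abs_C_le_one H.abs_S_le_one H.continuous_C
    H.continuous_S hi
  have hee : e * e = 1 := by rcases he with rfl | rfl <;> ring
  have htt : t * t = 1 := by rcases ht with rfl | rfl <;> ring
  set lam := fun w : ℂ => e / 4 * (w - 1 / w)
  set mu := fun w : ℂ => t / 4 * (w + 1 / w)
  have hrel : mu z ^ 2 - lam z ^ 2 = 1 / 4 := by
    simp only [lam, mu]
    field_simp
    linear_combination (z ^ 2 + 1) ^ 2 * htt - (z ^ 2 - 1) ^ 2 * hee
  obtain ⟨hm0, hl0⟩ := hφ.im_eq_zero H him hrel hlim.1 hlim.2 hne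
  refine ⟨norm_eq_one_of_re_of_im hz ?_ ?_, ?_⟩
  · have : (lam z).re = 0 := hl0
    rcases he with rfl | rfl <;> simpa [lam] using this
  · have : (mu z).im = 0 := hm0
    rcases ht with rfl | rfl <;> simpa [mu] using this
  obtain ⟨p, q, hp, hq, hle, hpq0⟩ := hφ.exists_real hl0 hm0 (hne 0)
  have hpc : Continuous p := continuous_iff_continuousAt.2 fun x => (hp x).continuousAt
  have hqc : Continuous q := continuous_iff_continuousAt.2 fun x => (hq x).continuousAt
  have hlz : ((lam z).im : ℂ) * Complex.I = lam z := by
    apply Complex.ext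
    · rw [Complex.re_ofReal_mul, Complex.I_re, mul_zero]; exact hl0.symm
    · simp
  have hmz : ((mu z).re : ℂ) = mu z := by
    apply Complex.ext
    · simp
    · rw [Complex.ofReal_im]; exact hm0.symm
  have hsol := Sol.ofReal hp hq
  change Sol C S ((lam z).im * Complex.I) (mu z).re _ _ at hsol
  rw [hlz, hmz] at hsol
  have hden := Sol.density_ofReal p q
  have hne' : ∀ x, density (fun x => (p x : ℂ)) (fun x => q x * Complex.I) x ≠ 0 := fun x hx => by
    have := hsol.density_eq_zero H.abs_C_le_one H.abs_S_le_one hx 0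
    rw [hden] at this
    exact hpq0 this
  have hnn : ∀ x, 0 ≤ p x ^ 2 + q x ^ 2 := fun x => by positivity
  have hbot : Tendsto (fun x => p x ^ 2 + q x ^ 2) atBot (𝓝 0) := squeeze_zero hnn hle hlim.1
  have htop : Tendsto (fun x => p x ^ 2 + q x ^ 2) atTop (𝓝 0) := squeeze_zero hnn hle hlim.2
  have hi2 : Integrable fun x => p x ^ 2 + q x ^ 2 :=
    hi.mono' (by fun_prop : Continuous fun x => p x ^ 2 + q x ^ 2).aestronglyMeasurable
      (Eventually.of_forall fun x => by rw [Real.norm_of_nonneg (hnn x)]; exact hle x)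
  have hform := Sol.integrable_form H hpc hqc hi2 (A := (lam z).im) (B := (mu z).re)
  have hpos := Sol.integral_form_pos him H hp hq hbot htop (by simpa [hden] using hne') hform
  have hvar : Sol.variation C S (e / 4 * (1 + 1 / z ^ 2)) (t / 4 * (1 - 1 / z ^ 2))
      (fun x => (p x : ℂ)) (fun x => q x * Complex.I) (fun x => (p x : ℂ))
      (fun x => q x * Complex.I)
      = fun x => e * t / z * (Sol.form C S p q (lam z).im (mu z).re x : ℂ) := by
    funext x
    -- Up to the common factor `e t / z`, differentiation in `z` exchanges `lam` and `mu`; this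
    -- identifies the variation with `form`.
    have h1 : e / 4 * (1 + 1 / z ^ 2) = e * t / z * mu z := by
      simp only [mu]
      field_simp
      linear_combination -(e * (z ^ 2 + 1)) * htt
    have h2 : t / 4 * (1 - 1 / z ^ 2) = e * t / z * lam z := by
      simp only [lam]
      field_simp
      linear_combination -(t * (z ^ 2 - 1)) * hee
    rw [h1, h2, ← Sol.variation_ofReal, hlz, hmz]
  obtain ⟨F, G, P, Q, c, hc0, hev, hd⟩ := Sol.exists_jost_pair H (hasDerivAt_sub_inv hz e)
    (hasDerivAt_add_inv hz t) him hsol (by rw [hden]; exact hbot) (by rw [hden]; exact htop) hne'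
    (by rw [hvar]; exact hform.ofReal.const_mul _)
  refine ⟨F, G, P, Q, _, ?_, hev, hd⟩
  rw [hvar, integral_const_mul, integral_complex_ofReal]
  have he0 : e ≠ 0 := left_ne_zero_of_mul_eq_one hee
  have ht0 : t ≠ 0 := left_ne_zero_of_mul_eq_one htt
  exact mul_ne_zero hc0 (mul_ne_zero (div_ne_zero (mul_ne_zero he0 ht0) hz)
    (Complex.ofReal_ne_zero.2 hpos.ne'))

end SineGordon
-- From the potential to a lobe profile
namespace SineGordon

lemma pos_or_neg_of_ne_zero {s : Set ℝ} (hs : IsPreconnected s) {φ : ℝ → ℝ}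
    (hφ : ContinuousOn φ s) (h0 : ∀ x ∈ s, φ x ≠ 0) :
    (∀ x ∈ s, 0 < φ x) ∨ (∀ x ∈ s, φ x < 0) := by
  by_contra! hcon
  obtain ⟨⟨x, hx, hx0⟩, y, hy, hy0⟩ := hcon
  obtain ⟨w, hw, hw0⟩ := hs.intermediate_value hx hy hφ ⟨hx0, hy0⟩
  exact h0 w hw hw0

/-- The derivative has one sign to the left of `x₀`; a negative one would push `s` below its limit
`0` at `-∞`. -/
lemma pos_of_nonneg_of_tendsto {s d : ℝ → ℝ} {x₀ : ℝ} (hd : ∀ x, HasDerivAt s (d x) x)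
    (hc : Continuous d) (h0 : ∀ x < x₀, d x ≠ 0) (hs : ∀ x, 0 ≤ s x)
    (hlim : Tendsto s atBot (𝓝 0)) : (∀ x < x₀, 0 < d x) ∧ ∀ x ≤ x₀, 0 < s x := by
  have h1 : ∀ x < x₀, 0 < d x := by
    rcases pos_or_neg_of_ne_zero isPreconnected_Iio hc.continuousOn h0 with h | h
    · exact h
    · exact absurd (neg_of_deriv_neg hd h hlim) (not_lt.2 (hs x₀))
  refine ⟨h1, fun x hx => ?_⟩
  have := neg_of_deriv_neg (h := fun x => -s x) (fun y => (hd y).neg) (x₁ := x)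
    (fun y hy => neg_lt_zero.2 (h1 y (hy.trans_le hx))) (by simpa using hlim.neg)
  linarith

/-- Under the hypotheses of the theorem `(cos (u / 2), sin (u / 2))` is, up to signs, a lobe
profile. -/
lemma exists_lobe {u : ℝ → ℝ} (hu : ContDiff ℝ 1 u) {k : ℤ}
    (hbot : Tendsto u atBot (𝓝 (2 * Real.pi * (k : ℝ))))
    (htop : Tendsto u atTop (𝓝 (2 * Real.pi * (k : ℝ))))
    (hsin : Integrable (fun x : ℝ => Real.sin (u x / 2)) volume)
    (hsign : (∀ x : ℝ, 0 ≤ Real.sin (u x / 2)) ∨ (∀ x : ℝ, Real.sin (u x / 2) ≤ 0))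
    {x₀ : ℝ} (hcrit : ∀ x : ℝ, deriv (fun y : ℝ => Real.sin (u y / 2)) x = 0 ↔ x = x₀)
    (hheight : |u x₀ - 2 * Real.pi * (k : ℝ)| < Real.pi) :
    ∃ e t : ℝ, (e = 1 ∨ e = -1) ∧ (t = 1 ∨ t = -1) ∧ ∃ dS : ℝ → ℝ,
      Lobe (fun x => e * Real.cos (u x / 2)) (fun x => t * Real.sin (u x / 2)) dS x₀ := by
  have hud : ∀ x, HasDerivAt u (deriv u x) x := fun x =>
    (hu.differentiable one_ne_zero x).hasDerivAt
  have huc := hu.continuous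
  have hu'c : Continuous (deriv u) := hu.continuous_deriv le_rfl
  have hs : ∀ x, HasDerivAt (fun y => Real.sin (u y / 2)) (Real.cos (u x / 2) * (deriv u x / 2)) x :=
    fun x => ((hud x).div_const 2).sin
  have hcos : ∀ x, HasDerivAt (fun y => Real.cos (u y / 2))
      (-Real.sin (u x / 2) * (deriv u x / 2)) x := fun x => ((hud x).div_const 2).cos
  have hcrit' : ∀ x, Real.cos (u x / 2) * (deriv u x / 2) = 0 ↔ x = x₀ := fun x => by
    rw [← (hs x).deriv]; exact hcrit x
  -- A zero of the cosine is a critical point of `sin (u / 2)`, hence `x₀`, and the height condition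
  -- keeps `u x₀ / 2` within `π/2` of `kπ`.
  have hC0 : ∀ x, Real.cos (u x / 2) ≠ 0 := by
    intro x hx
    have hxx : x = x₀ := (hcrit' x).1 (by rw [hx, zero_mul])
    subst hxx
    have h1 : 0 < Real.cos (u x / 2 - k * Real.pi) := by
      obtain ⟨h2, h3⟩ := abs_lt.1 hheight
      exact Real.cos_pos_of_mem_Ioo ⟨by linarith, by linarith⟩
    rw [Real.cos_sub_int_mul_pi, hx, mul_zero] at h1
    exact lt_irrefl _ h1
  obtain ⟨e, he, hepos⟩ : ∃ e : ℝ, (e = 1 ∨ e = -1) ∧ ∀ x, 0 < e * Real.cos (u x / 2) := by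
    rcases pos_or_neg_of_ne_zero isPreconnected_univ
      (by fun_prop : Continuous fun x => Real.cos (u x / 2)).continuousOn
      (fun x _ => hC0 x) with h | h
    · exact ⟨1, Or.inl rfl, fun x => by simpa using h x trivial⟩
    · exact ⟨-1, Or.inr rfl, fun x => by simpa using h x trivial⟩
  obtain ⟨t, ht, htnn⟩ : ∃ t : ℝ, (t = 1 ∨ t = -1) ∧ ∀ x, 0 ≤ t * Real.sin (u x / 2) := by
    rcases hsign with h | h
    · exact ⟨1, Or.inl rfl, fun x => by simpa using h x⟩
    · exact ⟨-1, Or.inr rfl, fun x => by simpa using h x⟩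
  have hee : e * e = 1 := by rcases he with rfl | rfl <;> ring
  have htt : t * t = 1 := by rcases ht with rfl | rfl <;> ring
  have ht0 : t ≠ 0 := left_ne_zero_of_mul_eq_one htt
  have hsinlim : ∀ {L : Filter ℝ}, Tendsto u L (𝓝 (2 * Real.pi * (k : ℝ))) →
      Tendsto (fun x => t * Real.sin (u x / 2)) L (𝓝 0) := fun {L} h => by
    have h1 := (((Real.continuous_sin.tendsto _).comp (h.div_const 2)).const_mul t)
    rwa [show 2 * Real.pi * (k : ℝ) / 2 = k * Real.pi by ring, Real.sin_int_mul_pi, mul_zero] at h1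
  set dS : ℝ → ℝ := fun x => t * (Real.cos (u x / 2) * (deriv u x / 2)) with hdS
  have hdSc : Continuous dS := by fun_prop
  have hSd : ∀ x, HasDerivAt (fun x => t * Real.sin (u x / 2)) (dS x) x :=
    fun x => (hs x).const_mul t
  have hdS0 : ∀ x, x ≠ x₀ → dS x ≠ 0 := fun x hx =>
    mul_ne_zero ht0 fun h => hx ((hcrit' x).1 h)
  obtain ⟨hl1, hl2⟩ := pos_of_nonneg_of_tendsto hSd hdSc (fun x hx => hdS0 x hx.ne) htnn
    (hsinlim hbot)
  obtain ⟨hr1, hr2⟩ := pos_of_nonneg_of_tendsto (s := fun x => t * Real.sin (u (-x) / 2))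
    (d := fun x => -dS (-x)) (x₀ := -x₀)
    (fun x => ((hSd (-x)).scomp x (hasDerivAt_neg x)).congr_deriv (by simp))
    (by fun_prop) (fun x hx => neg_ne_zero.2 (hdS0 _ (by linarith [neg_lt_neg hx] : -x > x₀).ne'))
    (fun x => htnn (-x)) ((hsinlim htop).comp tendsto_neg_atBot_atTop)
  refine ⟨e, t, he, ht, dS, ?_⟩
  exact
  { C_pos := hepos
    S_pos := fun x => by
      rcases le_total x x₀ with h | h
      · exact hl2 x h
      · simpa using hr2 (-x) (neg_le_neg h)
    sq_add_sq := fun x => by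
      linear_combination Real.cos (u x / 2) ^ 2 * hee + Real.sin (u x / 2) ^ 2 * htt
        + Real.sin_sq_add_cos_sq (u x / 2)
    hasDerivAt_S := hSd
    hasDerivAt_C := fun x => ((hcos x).const_mul e).congr_deriv (by
      have h1 := (hepos x).ne'
      rw [← neg_div, eq_div_iff h1]
      simp only [hdS]
      linear_combination (-Real.sin (u x / 2) * (deriv u x / 2) * Real.cos (u x / 2)) * (hee - htt))
    dS_nonneg := fun x hx => (hl1 x hx).le
    dS_nonpos := fun x hx => by
      have := hr1 (-x) (neg_lt_neg hx)
      simp only [neg_neg] at this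
      linarith
    tendsto_bot := hsinlim hbot
    tendsto_top := hsinlim htop
    integrable := hsin.const_mul t }

variable {u : ℝ → ℝ} {e t : ℝ}

/-- Each sign enters once in the profile and once in the parameter, so it cancels by `e² = t² = 1`.
-/
lemma isSolution_iff_sol (he : e = 1 ∨ e = -1) (ht : t = 1 ∨ t = -1) {w : ℂ}
    {Φ : ℝ → Fin 2 → ℂ} :
    IsSolution u w Φ ↔ Sol (fun x => e * Real.cos (u x / 2)) (fun x => t * Real.sin (u x / 2))
      ((e : ℂ) / 4 * (w - 1 / w)) ((t : ℂ) / 4 * (w + 1 / w)) (fun x => Φ x 0) (fun x => Φ x 1) := by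
  have hee : (e : ℂ) * e = 1 := by rcases he with rfl | rfl <;> simp
  have htt : (t : ℂ) * t = 1 := by rcases ht with rfl | rfl <;> simp
  have e0 : ∀ x, ((coeff u w x).mulVec (Φ x)) 0 = -Complex.I * ((e : ℂ) / 4 * (w - 1 / w))
      * (e * Real.cos (u x / 2) : ℝ) * Φ x 0
      + Complex.I * ((t : ℂ) / 4 * (w + 1 / w)) * (t * Real.sin (u x / 2) : ℝ) * Φ x 1 := fun x => by
    simp only [coeff, tau1, tau2, Matrix.mulVec, dotProduct, Fin.sum_univ_two]
    simp
    linear_combination (Complex.I * (1 / 4 * (w - w⁻¹)) * Complex.cos (u x / 2) * Φ x 0) * hee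
      - (Complex.I * (1 / 4 * (w + w⁻¹)) * Complex.sin (u x / 2) * Φ x 1) * htt
  have e1 : ∀ x, ((coeff u w x).mulVec (Φ x)) 1 = Complex.I * ((t : ℂ) / 4 * (w + 1 / w))
      * (t * Real.sin (u x / 2) : ℝ) * Φ x 0
      + Complex.I * ((e : ℂ) / 4 * (w - 1 / w)) * (e * Real.cos (u x / 2) : ℝ) * Φ x 1 := fun x => by
    simp only [coeff, tau1, tau2, Matrix.mulVec, dotProduct, Fin.sum_univ_two]
    simp
    linear_combination -(Complex.I * (1 / 4 * (w - w⁻¹)) * Complex.cos (u x / 2) * Φ x 1) * hee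
      - (Complex.I * (1 / 4 * (w + w⁻¹)) * Complex.sin (u x / 2) * Φ x 0) * htt
  constructor
  · intro h
    refine ⟨fun x => ?_, fun x => ?_⟩
    · rw [← e0]; exact hasDerivAt_pi.1 (h x) 0
    · rw [← e1]; exact hasDerivAt_pi.1 (h x) 1
  · intro h x
    refine hasDerivAt_pi.2 fun i => ?_
    fin_cases i
    · exact (h.left x).congr_deriv (e0 x).symm
    · exact (h.right x).congr_deriv (e1 x).symm

lemma planeWave_zero (he : e = 1 ∨ e = -1) (w : ℂ) (x : ℝ) :
    planeWave u w 0 x = Complex.exp (-(Complex.I * ((e : ℂ) / 4 * (w - 1 / w))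
      * phase (fun x => e * Real.cos (u x / 2)) x)) := by
  have hee : (e : ℂ) * e = 1 := by rcases he with rfl | rfl <;> simp
  rw [planeWave, phase, intervalIntegral.integral_const_mul]
  congr 1
  simp only [tau1, Complex.ofReal_mul, Matrix.of_apply, Matrix.cons_val_zero]
  linear_combination (1 / 4 * Complex.I * (w - 1 / w)
    * ((∫ y in (0 : ℝ)..x, Real.cos (u y / 2) : ℝ) : ℂ)) * hee

lemma planeWave_one (he : e = 1 ∨ e = -1) (w : ℂ) (x : ℝ) :
    planeWave u w 1 x = Complex.exp (Complex.I * ((e : ℂ) / 4 * (w - 1 / w))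
      * phase (fun x => e * Real.cos (u x / 2)) x) := by
  have hee : (e : ℂ) * e = 1 := by rcases he with rfl | rfl <;> simp
  rw [planeWave, phase, intervalIntegral.integral_const_mul]
  congr 1
  simp only [tau1, Complex.ofReal_mul, Matrix.of_apply, Matrix.cons_val_one]
  simp
  linear_combination -(1 / 4 * Complex.I * (w - w⁻¹)
    * ((∫ y in (0 : ℝ)..x, Real.cos (u y / 2) : ℝ) : ℂ)) * hee

lemma isJost_of_exp {w : ℂ} {L : Filter ℝ} {Ψ : ℝ → Fin 2 → ℂ} {κ : ℝ → ℂ} (j : Fin 2)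
    (hsol : IsSolution u w Ψ) (hpw : ∀ x, planeWave u w j x = Complex.exp (-κ x))
    (hκ : Tendsto (fun x => (κ x).re) L atTop)
    (h1 : ∀ i, Tendsto (fun x => Complex.exp (κ x) * Ψ x i) L
      (𝓝 ((Pi.single j 1 : Fin 2 → ℂ) i))) :
    IsJost u w L Ψ := by
  refine ⟨hsol, j, ?_, tendsto_pi_nhds.2 fun i => (h1 i).congr fun x => ?_⟩
  · rw [tendsto_zero_iff_norm_tendsto_zero]
    refine (Real.tendsto_exp_neg_atTop_nhds_zero.comp hκ).congr fun x => ?_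
    rw [hpw, Complex.norm_exp, Complex.neg_re, Function.comp_apply]
  · rw [hpw, Pi.smul_apply, smul_eq_mul, Complex.exp_neg, inv_inv]

lemma integrable_density {Φ : ℝ → Fin 2 → ℂ} (hc : Continuous Φ) (h : MemLp Φ 2 volume) :
    Integrable (density (fun x => Φ x 0) (fun x => Φ x 1)) := by
  have h1 : Integrable (fun x => ‖Φ x‖ ^ 2) := h.integrable_norm_pow two_ne_zero
  have hcn := Complex.continuous_normSq
  refine (h1.const_mul 2).mono' (Continuous.aestronglyMeasurable ?_)
    (Eventually.of_forall fun x => ?_)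
  · unfold density
    exact (hcn.comp (by fun_prop)).add (hcn.comp (by fun_prop))
  · rw [Real.norm_of_nonneg (Sol.density_nonneg _ _ _), density, Complex.normSq_eq_norm_sq,
      Complex.normSq_eq_norm_sq]
    have := norm_le_pi_norm (Φ x) 0
    have := norm_le_pi_norm (Φ x) 1
    have h2 : ‖Φ x 0‖ ^ 2 ≤ ‖Φ x‖ ^ 2 := by gcongr
    have h3 : ‖Φ x 1‖ ^ 2 ≤ ‖Φ x‖ ^ 2 := by gcongr
    linarith

end SineGordon
-- Assembly for a single eigenvalue
namespace SineGordon

lemma eventually_im_pos {z : ℂ} (hz : z ≠ 0) {e : ℂ} (h : 0 < (e / 4 * (z - 1 / z)).im) :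
    ∀ᶠ w in 𝓝 z, 0 < (e / 4 * (w - 1 / w)).im :=
  (Complex.continuous_im.continuousAt.comp (hasDerivAt_sub_inv hz e).continuousAt).eventually
    (lt_mem_nhds h)

section jost

variable {C S dS : ℝ → ℝ} {x₀ : ℝ} {u : ℝ → ℝ} {l w : ℂ} {Ψ : ℝ → Fin 2 → ℂ}

lemma Lobe.isJost_atBot (H : Lobe C S dS x₀) (j : Fin 2) (hsol : IsSolution u w Ψ)
    (hpw : ∀ x, planeWave u w j x = Complex.exp (-(Complex.I * l * phase C x))) (hl : 0 < l.im)
    (h : ∀ i, Tendsto (fun x => Complex.exp (Complex.I * l * phase C x) * Ψ x i) atBot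
      (𝓝 ((Pi.single j 1 : Fin 2 → ℂ) i))) : IsJost u w atBot Ψ := by
  refine isJost_of_exp j hsol hpw ?_ h
  refine (tendsto_neg_atBot_atTop.comp (H.tendsto_phase.const_mul_atBot hl)).congr fun x => ?_
  simp

lemma Lobe.isJost_atTop (H : Lobe C S dS x₀) (j : Fin 2) (hsol : IsSolution u w Ψ)
    (hpw : ∀ x, planeWave u w j x = Complex.exp (Complex.I * l * phase C x)) (hl : 0 < l.im)
    (h : ∀ i, Tendsto (fun x => Complex.exp (-(Complex.I * l * phase C x)) * Ψ x i) atTop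
      (𝓝 ((Pi.single j 1 : Fin 2 → ℂ) i))) : IsJost u w atTop Ψ := by
  refine isJost_of_exp j hsol (fun x => by rw [hpw, neg_neg]) ?_ h
  have h1 := H.reflect.tendsto_phase.comp tendsto_neg_atTop_atBot
  refine (tendsto_neg_atBot_atTop.comp (h1.const_mul_atBot hl)).congr fun x => ?_
  simp [phase_comp_neg]

end jost

section eigenfunctions

variable {u : ℝ → ℝ} {e t x₀ : ℝ} {dS : ℝ → ℝ} {z : ℂ} {Φ Φ₁ Φ₂ : ℝ → Fin 2 → ℂ}

lemma IsEigenfunction.integrable_density (h : IsEigenfunction u z Φ) :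
    Integrable (density (fun x => Φ x 0) (fun x => Φ x 1)) :=
  SineGordon.integrable_density
    (continuous_iff_continuousAt.2 fun x => (h.1 x).continuousAt) h.2.1

lemma IsEigenfunction.density_ne_zero
    (H : Lobe (fun x => e * Real.cos (u x / 2)) (fun x => t * Real.sin (u x / 2)) dS x₀)
    (he : e = 1 ∨ e = -1) (ht : t = 1 ∨ t = -1) (h : IsEigenfunction u z Φ) (x : ℝ) :
    density (fun x => Φ x 0) (fun x => Φ x 1) x ≠ 0 := by
  intro hx
  refine h.2.2 (funext fun y => ?_)
  have := Sol.eq_zero_of_density (((isSolution_iff_sol he ht).1 h.1).density_eq_zero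
    H.abs_C_le_one H.abs_S_le_one hx y)
  funext i
  fin_cases i
  · exact this.1
  · exact this.2

lemma IsEigenfunction.tendsto_density
    (H : Lobe (fun x => e * Real.cos (u x / 2)) (fun x => t * Real.sin (u x / 2)) dS x₀)
    (he : e = 1 ∨ e = -1) (ht : t = 1 ∨ t = -1) (h : IsEigenfunction u z Φ) :
    Tendsto (density (fun x => Φ x 0) (fun x => Φ x 1)) atBot (𝓝 0) :=
  (((isSolution_iff_sol he ht).1 h.1).tendsto_density_zero H.abs_C_le_one H.abs_S_le_one
    H.continuous_C H.continuous_S h.integrable_density).1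

lemma IsEigenfunction.proportional
    (H : Lobe (fun x => e * Real.cos (u x / 2)) (fun x => t * Real.sin (u x / 2)) dS x₀)
    (he : e = 1 ∨ e = -1) (ht : t = 1 ∨ t = -1) (h₁ : IsEigenfunction u z Φ₁)
    (h₂ : IsEigenfunction u z Φ₂) : ∃ c : ℂ, Φ₂ = c • Φ₁ := by
  have s₁ := (isSolution_iff_sol he ht).1 h₁.1
  have s₂ := (isSolution_iff_sol he ht).1 h₂.1
  obtain ⟨l1, l2⟩ := Sol.tendsto_components (h₁.tendsto_density H he ht)
  obtain ⟨l3, l4⟩ := Sol.tendsto_components (h₂.tendsto_density H he ht)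
  obtain ⟨c, hc⟩ := s₁.exists_proportional s₂ H.abs_C_le_one H.abs_S_le_one
    (h₁.density_ne_zero H he ht 0) (s₁.wronskian_eq_zero s₂ l1 l2 l3 l4 0)
  refine ⟨c, funext fun x => funext fun i => ?_⟩
  fin_cases i
  · exact (hc x).1
  · exact (hc x).2

/-- The part of the theorem concerning one eigenvalue. -/
lemma IsEigenfunction.norm_eq_one_and_simple
    (H : Lobe (fun x => e * Real.cos (u x / 2)) (fun x => t * Real.sin (u x / 2)) dS x₀)
    (he : e = 1 ∨ e = -1) (ht : t = 1 ∨ t = -1) (hz : z ≠ 0) (h : IsEigenfunction u z Φ) :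
    ‖z‖ = 1 ∧ ∃ Ψ Φ : ℂ → ℝ → Fin 2 → ℂ,
      (∀ᶠ w in 𝓝 z, IsJost u w atBot (Ψ w) ∧ IsJost u w atTop (Φ w)) ∧
      ∃ W' : ℂ, HasDerivAt (fun w => wronskian (Ψ w 0) (Φ w 0)) W' z ∧ W' ≠ 0 := by
  have hs := (isSolution_iff_sol he ht).1 h.1
  have hne := h.density_ne_zero H he ht
  have he' : (e : ℂ) = 1 ∨ (e : ℂ) = -1 := by rcases he with rfl | rfl <;> simp
  have ht' : (t : ℂ) = 1 ∨ (t : ℂ) = -1 := by rcases ht with rfl | rfl <;> simp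
  rcases lt_trichotomy ((e : ℂ) / 4 * (z - 1 / z)).im 0 with him | him | him
  -- Exchanging the components replaces `e` by `-e` in the parameter while the profile stays the
  -- same. The Jost vectors trade places accordingly, and the Wronskian changes sign.
  · have hneg : ∀ w : ℂ, -((e : ℂ) / 4 * (w - 1 / w)) = -(e : ℂ) / 4 * (w - 1 / w) := fun w => by
      ring
    have hs' := hs.swap
    rw [hneg] at hs'
    have him' : 0 < (-(e : ℂ) / 4 * (z - 1 / z)).im := by
      rw [← hneg, Complex.neg_im]; linarith
    have hsym : density (fun x => Φ x 1) (fun x => Φ x 0)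
        = density (fun x => Φ x 0) (fun x => Φ x 1) := funext fun x => add_comm _ _
    obtain ⟨h1, F, G, P, Q, W', hW, hev, hd⟩ := H.norm_eq_one_and_exists_jost
      (e := -(e : ℂ)) (by rcases he' with h | h <;> simp [h]) ht' hz him' hs'
      (by rw [hsym]; exact h.integrable_density) (by rw [hsym]; exact hne)
    refine ⟨h1, fun w x => ![G w x, F w x], fun w x => ![Q w x, P w x], ?_, -W', ?_,
      neg_ne_zero.2 hW⟩
    · filter_upwards [hev, eventually_im_pos hz him'] with w hw hw'
      obtain ⟨⟨a1, a2, a3⟩, b1, b2, b3⟩ := hw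
      have a1' := a1.swap
      have b1' := b1.swap
      rw [← hneg, neg_neg] at a1' b1'
      refine ⟨H.isJost_atBot 1 ((isSolution_iff_sol he ht).2 (by simpa using a1'))
          (fun x => ?_) hw' (fun i => ?_),
        H.isJost_atTop 0 ((isSolution_iff_sol he ht).2 (by simpa using b1'))
          (fun x => ?_) hw' (fun i => ?_)⟩
      · rw [planeWave_one he, ← hneg]; congr 1; ring
      · fin_cases i
        · simpa using a3
        · simpa using a2
      · rw [planeWave_zero he, ← hneg]; congr 1; ring
      · fin_cases i
        · simpa using b3
        · simpa using b2
    · refine (hd.neg).congr_of_eventuallyEq (Eventually.of_forall fun w => ?_)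
      simp [wronskian]
  -- A real `z - 1/z` forces `z` to be real, so both parameters are real and the density is a
  -- nonzero constant, which contradicts its decay.
  · exfalso
    have h1 : (z - 1 / z).im = 0 := by
      rcases he' with h | h <;> simpa [h] using him
    have h2 := add_inv_im_eq_zero hz h1
    exact hs.im_ne_zero (h.tendsto_density H he ht) hne
      (by rcases ht' with h | h <;> simpa [h] using h2) him
  · obtain ⟨h1, F, G, P, Q, W', hW, hev, hd⟩ := H.norm_eq_one_and_exists_jost
      he' ht' hz him hs h.integrable_density hne
    refine ⟨h1, fun w x => ![F w x, G w x], fun w x => ![P w x, Q w x], ?_, W', ?_, hW⟩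
    · filter_upwards [hev, eventually_im_pos hz him] with w hw hw'
      obtain ⟨⟨a1, a2, a3⟩, b1, b2, b3⟩ := hw
      refine ⟨H.isJost_atBot 0 ((isSolution_iff_sol he ht).2 (by simpa using a1))
          (planeWave_zero he w) hw' (fun i => ?_),
        H.isJost_atTop 1 ((isSolution_iff_sol he ht).2 (by simpa using b1))
          (planeWave_one he w) hw' (fun i => ?_)⟩
      · fin_cases i
        · simpa using a2
        · simpa using a3
      · fin_cases i
        · simpa using b2
        · simpa using b3
    · refine hd.congr_of_eventuallyEq (Eventually.of_forall fun w => ?_)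
      simp [wronskian]

end eigenfunctions

end SineGordon

theorem mainTheorem1 (u : ℝ → ℝ) (hu : ContDiff ℝ 1 u)
    (k : ℤ)
    (hbot : Tendsto u atBot (𝓝 (2 * Real.pi * (k : ℝ))))
    (htop : Tendsto u atTop (𝓝 (2 * Real.pi * (k : ℝ))))
    (hsin : Integrable (fun x : ℝ => Real.sin (u x / 2)) volume)
    (hcos : Integrable (fun x : ℝ => 1 - |Real.cos (u x / 2)|) volume)
    (hsign : (∀ x : ℝ, 0 ≤ Real.sin (u x / 2)) ∨ (∀ x : ℝ, Real.sin (u x / 2) ≤ 0))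
    (x₀ : ℝ)
    (hcrit : ∀ x : ℝ, deriv (fun y : ℝ => Real.sin (u y / 2)) x = 0 ↔ x = x₀)
    (hheight : |u x₀ - 2 * Real.pi * (k : ℝ)| < Real.pi) :
    ∀ z : ℂ, SineGordon.IsEigenvalue u z →
      ‖z‖ = 1 ∧ SineGordon.IsSimpleEigenvalue u z := by
  rintro z ⟨hz, Φ, hΦ⟩
  obtain ⟨e, t, he, ht, dS, H⟩ :=
    SineGordon.exists_lobe hu hbot htop hsin hsign hcrit hheight
  obtain ⟨h1, h2⟩ := hΦ.norm_eq_one_and_simple H he ht hz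
  exact ⟨h1, ⟨hz, Φ, hΦ⟩, fun _ _ h₁ h₂ => h₁.proportional H he ht h₂, h2⟩
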